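/- All $C^*$-algebras are complex and unital, and $\otimes$ is the maximal $C^*$-tensor product. A Hopf $C^*$-algebra is a $C^*$-algebra $A$ with unital $*$-homomorphisms $\Delta:A\to A\otimes A$, $\varepsilon:A\to\mathbb C$ and $S:A\to A^{op}$ satisfying coassociativity, the counit axioms and $S^2=\mathrm{id}$, and having a dense unital $*$-subalgebra $A_0$ with $S(A_0)\subseteq A_0$, such that for each $a\in A_0$ the element $\Delta(a)$ is the image of some $t$ in the algebraic tensor product $A_0\odot A_0$ with $m(S\odot\mathrm{id})t=\varepsilon(a)1=m(\mathrm{id}\odot S)t$, where $m$ is the multiplication. A morphism of Hopf $C^*$-algebras is a unital $*$-homomorphism compatible with $\Delta$, $\varepsilon$ and $S$. A magic unitary is a square matrix whose entries are projections and each of whose rows and columns consists of pairwise orthogonal projections with sum $1$. For a finite simple graph $X$ with adjacency matrix $d_X$, let $A(X)$ be the universal $C^*$-algebra generated by the entries $u_{ij}$ ($i,j$ vertices of $X$) of a magic unitary $u$ with $d_Xu=ud_X$. For $C^*$-algebras $A,B$ and square matrices $u$ over $A$ and $v$ over $B$, with $v$ of size $n$, the free wreath product is $$A*_wB=(A^{*n}*B)/\langle[u^{(a)}_{ij},v_{ab}]=0\rangle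 ,$$ where $*$ is the unital free product, $x\mapsto x^{(a)}$ is the canonical map from the $a$-th copy of $A$, and the relations are imposed for all $i,j,a,b$; put $w_{ia,jb}=u^{(a)}_{ij}v_{ab}$. The lexicographic product $X\circ Y$ is the graph whose vertices are the pairs $(i,a)$, with $i$ a vertex of $X$ and $a$ a vertex of $Y$, where $(i,a)\sim(j,b)$ if and only if $a\sim b$, or $a=b$ and $i\sim j$. **Proposition.** Let $X$ and $Y$ be finite simple graphs, with $X$ nonempty. Let $u$, $v$ and $W$ be the generating magic unitaries of $A(X)$, $A(Y)$ and $A(X\circ Y)$, and let $w$ be the matrix above for $A(X)*_wA(Y)$. Each of $A(X)$, $A(Y)$, $A(X\circ Y)$ and $A(X)*_wA(Y)$ has exactly one Hopf $C^*$-algebra structure for which its matrix $z=u,v,W,w$, respectively, is a magic unitary with $$\Delta(z_{pq})=\sum_r z_{pr}\otimes z_{rq},\qquad \varepsilon(z_{pq})=\delta_{pq},\qquad S(z_{pq})=z_{qp}.$$ For these structures, there is a surjective morphism of Hopf $C^*$-algebras $$\varphi:A(X\circ Y)\longrightarrow A(X)*_wA(Y)$$ with $\varphi(W_{ia,jb})=w_{ia,jb}=u^{(a)}_{ij}v_{ab}$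 for all $i,j,a,b$. -/

import Mathlib

open scoped TensorProduct

noncomputable section

/-! ### C⋆-seminorms and enveloping C⋆-algebras -/

/-- A C⋆-seminorm on a complex unital ⋆-algebra. -/
structure CStarSeminorm (F : Type*) [Ring F] [StarRing F] [Algebra ℂ F] extends
    Seminorm ℂ F where
  mul_le' : ∀ x y, toFun (x * y) ≤ toFun x * toFun y
  star_mul_self' : ∀ x, toFun (star x * x) = toFun x * toFun x

namespace CStarSeminorm

variable {F : Type*} [Ring F] [StarRing F] [Algebra ℂ F]

instance : CoeFun (CStarSeminorm F) (fun _ => F → ℝ) := ⟨fun p => p.toSeminorm⟩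

theorem mul_le (p : CStarSeminorm F) (x y : F) : p (x * y) ≤ p x * p y := p.mul_le' x y

theorem star_mul_self (p : CStarSeminorm F) (x : F) : p (star x * x) = p x * p x :=
  p.star_mul_self' x

theorem nonneg (p : CStarSeminorm F) (x : F) : 0 ≤ p x := apply_nonneg p.toSeminorm x

theorem le_star (p : CStarSeminorm F) (x : F) : p x ≤ p (star x) := by
  have h := p.mul_le (star x) x
  rw [p.star_mul_self] at h
  rcases (p.nonneg x).eq_or_lt with h0 | h0
  · rw [← h0]; exact p.nonneg _
  · exact le_of_mul_le_mul_right h h0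

theorem star_eq (p : CStarSeminorm F) (x : F) : p (star x) = p x :=
  le_antisymm (by simpa using p.le_star (star x)) (p.le_star x)

/-- The C⋆-seminorm that vanishes identically. -/
instance : Zero (CStarSeminorm F) :=
  ⟨{ (0 : Seminorm ℂ F) with
      mul_le' := fun _ _ => by change (0 : ℝ) ≤ 0 * 0; simp
      star_mul_self' := fun _ => by change (0 : ℝ) = 0 * 0; simp }⟩

theorem zero_apply (x : F) : (0 : CStarSeminorm F) x = 0 := rfl

/-- The ⋆-algebra `F`, seen as a seminormed space for the C⋆-seminorm `p`. -/
def Space (_p : CStarSeminorm F) : Type _ := F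

variable (p : CStarSeminorm F)

instance : Ring p.Space := inferInstanceAs (Ring F)
instance : StarRing p.Space := inferInstanceAs (StarRing F)
instance : Algebra ℂ p.Space := inferInstanceAs (Algebra ℂ F)
instance [StarModule ℂ F] : StarModule ℂ p.Space := inferInstanceAs (StarModule ℂ F)

instance : SeminormedRing p.Space :=
  { (inferInstance : Ring p.Space),
    p.toSeminorm.toAddGroupSeminorm.toSeminormedAddCommGroup with
    norm_mul_le := p.mul_le }

theorem norm_def (x : p.Space) : ‖x‖ = p (x : F) := rfl

instance : NormedAlgebra ℂ p.Space where
  norm_smul_le c x := le_of_eq (map_smul_eq_mul p.toSeminorm c (x : F))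

instance : NormedStarGroup p.Space where
  norm_star_le x := le_of_eq (p.star_eq x)

/-- The separated completion of `F` for the C⋆-seminorm `p`. -/
def Completion : Type _ := UniformSpace.Completion p.Space

instance : NormedRing p.Completion :=
  inferInstanceAs (NormedRing (UniformSpace.Completion p.Space))
instance : CompleteSpace p.Completion :=
  inferInstanceAs (CompleteSpace (UniformSpace.Completion p.Space))
instance : Algebra ℂ p.Completion :=
  inferInstanceAs (Algebra ℂ (UniformSpace.Completion p.Space))

/-- The canonical map of `F` to its completion. -/
def toCompletionFun (x : F) : p.Completion := 
  UniformSpace.Completion.coe' (α := p.Space) x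

theorem norm_toCompletionFun (x : F) : ‖p.toCompletionFun x‖ = p x :=
  UniformSpace.Completion.norm_coe (E := p.Space) x

theorem denseRange_toCompletionFun : DenseRange p.toCompletionFun :=
  UniformSpace.Completion.denseRange_coe (α := p.Space)

instance : Star p.Completion := ⟨UniformSpace.Completion.map (star : p.Space → p.Space)⟩

theorem star_toCompletionFun (x : F) :
    star (p.toCompletionFun x) = p.toCompletionFun (star x) :=
  UniformSpace.Completion.map_coe (f := (star : p.Space → p.Space))
    (starNormedAddGroupHom (E := p.Space)).uniformContinuous x

theorem continuous_star' : Continuous (star : p.Completion → p.Completion) :=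
  UniformSpace.Completion.continuous_map

theorem toCompletionFun_add (x y : F) :
    p.toCompletionFun (x + y) = p.toCompletionFun x + p.toCompletionFun y :=
  UniformSpace.Completion.coe_add (α := p.Space) x y

theorem toCompletionFun_mul (x y : F) :
    p.toCompletionFun (x * y) = p.toCompletionFun x * p.toCompletionFun y :=
  UniformSpace.Completion.coe_mul (α := p.Space) x y

theorem toCompletionFun_smul (c : ℂ) (x : F) :
    p.toCompletionFun (c • x) = c • p.toCompletionFun x :=
  UniformSpace.Completion.coe_smul (X := p.Space) c x

instance : NormedAlgebra ℂ p.Completion where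
  norm_smul_le c x := p.denseRange_toCompletionFun.induction_on x
    (isClosed_le (by
      simp only [Algebra.smul_def]
      exact continuous_norm.comp (continuous_const.mul continuous_id))
      (continuous_const.mul continuous_norm))
    fun x => by
      rw [← toCompletionFun_smul, norm_toCompletionFun, norm_toCompletionFun]
      exact (map_smul_eq_mul p.toSeminorm c x).le

instance : StarRing p.Completion where
  star_involutive x := p.denseRange_toCompletionFun.induction_on x
    (isClosed_eq (p.continuous_star'.comp p.continuous_star') continuous_id)
    fun x => by simp only [star_toCompletionFun, star_star]
  star_mul x y := p.denseRange_toCompletionFun.induction_on₂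
    (isClosed_eq (p.continuous_star'.comp continuous_mul)
      ((p.continuous_star'.comp continuous_snd).mul (p.continuous_star'.comp continuous_fst)))
    (fun x y => by simp only [← toCompletionFun_mul, star_toCompletionFun, star_mul]) x y
  star_add x y := p.denseRange_toCompletionFun.induction_on₂
    (isClosed_eq (p.continuous_star'.comp continuous_add)
      ((p.continuous_star'.comp continuous_fst).add (p.continuous_star'.comp continuous_snd)))
    (fun x y => by simp only [← toCompletionFun_add, star_toCompletionFun, star_add]) x y

/-- `p` respects the relations `x = y`, for all `x` and `y` with `r x y`. -/
def Respects (r : F → F → Prop) : Prop := ∀ x y, r x y → p (x - y) = 0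

/-- The canonical ⋆-homomorphism of `F` to its completion. -/
def toCompletion : F →⋆ₐ[ℂ] p.Completion where
  toFun := p.toCompletionFun
  map_one' := UniformSpace.Completion.coe_one (α := p.Space)
  map_mul' := p.toCompletionFun_mul
  map_zero' := UniformSpace.Completion.coe_zero (α := p.Space)
  map_add' := p.toCompletionFun_add
  commutes' := fun _ => rfl
  map_star' := fun x => (p.star_toCompletionFun x).symm

theorem norm_toCompletion (x : F) : ‖p.toCompletion x‖ = p x := p.norm_toCompletionFun x

theorem denseRange_toCompletion : DenseRange p.toCompletion := p.denseRange_toCompletionFun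

/-- The extension to the completion of a ⋆-homomorphism whose norm is bounded by `p`. -/
def lift {B : Type*} [CStarAlgebra B] (f : F →⋆ₐ[ℂ] B) (hf : ∀ x, ‖f x‖ ≤ p x) :
    p.Completion →⋆ₐ[ℂ] B :=
  let g : p.Space →+* B := (f : F →+* B)
  have hg : Continuous g := AddMonoidHomClass.continuous_of_bound g 1
    (fun x => by rw [one_mul]; exact hf x)
  let h : p.Completion →+* B := UniformSpace.Completion.extensionHom g hg
  have hh : ∀ x, h (p.toCompletionFun x) = f x := UniformSpace.Completion.extensionHom_coe g hg
  have hc : Continuous h := UniformSpace.Completion.continuous_extension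
  { h with
    commutes' := fun c => by
      change h (p.toCompletionFun (algebraMap ℂ F c)) = _
      rw [hh]
      exact AlgHomClass.commutes f c
    map_star' := fun x => p.denseRange_toCompletionFun.induction_on x
      (isClosed_eq (hc.comp p.continuous_star') hc.star)
      fun x => by
        change h (star (p.toCompletionFun x)) = star (h (p.toCompletionFun x))
        rw [star_toCompletionFun, hh, hh, map_star] }

theorem lift_toCompletion {B : Type*} [CStarAlgebra B] (f : F →⋆ₐ[ℂ] B)
    (hf : ∀ x, ‖f x‖ ≤ p x) (x : F) : p.lift f hf (p.toCompletion x) = f x :=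
  UniformSpace.Completion.extensionHom_coe (α := p.Space) (f : F →+* B)
    (AddMonoidHomClass.continuous_of_bound (show p.Space →+* B from (f : F →+* B)) 1
      (fun x => by rw [one_mul]; exact hf x)) x

variable [StarModule ℂ F]

instance : CStarAlgebra p.Completion where
  norm_mul_self_le x := p.denseRange_toCompletionFun.induction_on x
    (isClosed_le (continuous_norm.mul continuous_norm)
      (continuous_norm.comp (p.continuous_star'.mul continuous_id)))
    fun x => by
      simp only [star_toCompletionFun, ← toCompletionFun_mul, norm_toCompletionFun]
      exact (p.star_mul_self x).ge
  star_smul c x := p.denseRange_toCompletionFun.induction_on x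
    (isClosed_eq (p.continuous_star'.comp (continuous_const_smul c))
      (p.continuous_star'.const_smul (star c)))
    fun x => by simp only [← toCompletionFun_smul, star_toCompletionFun, star_smul]

end CStarSeminorm

section Enveloping

variable {F : Type*} [Ring F] [StarRing F] [Algebra ℂ F]

/-- The relations `r` on the ⋆-algebra `F` bound the norm of every element of `F`, so that the
universal C⋆-algebra with these relations exists. -/
class BoundedRelations (r : F → F → Prop) : Prop where
  bounded : ∀ x, ∃ C, ∀ p : CStarSeminorm F, p.Respects r → p x ≤ C

variable (r : F → F → Prop) [BoundedRelations r]

theorem BoundedRelations.bddAbove (x : F) :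
    BddAbove (Set.range fun p : {p : CStarSeminorm F // p.Respects r} => p.1 x) := by
  obtain ⟨C, hC⟩ := BoundedRelations.bounded (r := r) x
  exact ⟨C, by rintro _ ⟨p, rfl⟩; exact hC p.1 p.2⟩

instance : Nonempty {p : CStarSeminorm F // p.Respects r} := ⟨⟨0, fun _ _ _ => rfl⟩⟩

/-- The largest C⋆-seminorm on `F` that respects the relations `r`. -/
def maxCStarSeminorm : CStarSeminorm F where
  toFun x := ⨆ p : {p : CStarSeminorm F // p.Respects r}, p.1 x
  map_zero' := by
    have h : ∀ p : {p : CStarSeminorm F // p.Respects r}, p.1 (0 : F) = 0 :=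
      fun p => map_zero p.1.toSeminorm
    simp only [h, ciSup_const]
  add_le' x y := ciSup_le fun p => (map_add_le_add p.1.toSeminorm x y).trans
    (add_le_add (le_ciSup (BoundedRelations.bddAbove r x) p)
      (le_ciSup (BoundedRelations.bddAbove r y) p))
  neg' x := by
    have h : ∀ p : {p : CStarSeminorm F // p.Respects r}, p.1 (-x) = p.1 x :=
      fun p => map_neg_eq_map p.1.toSeminorm x
    simp only [h]
  smul' c x := by
    have h : ∀ p : {p : CStarSeminorm F // p.Respects r}, p.1 (c • x) = ‖c‖ * p.1 x :=
      fun p => map_smul_eq_mul p.1.toSeminorm c x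
    simp only [h]
    exact (Real.mul_iSup_of_nonneg (norm_nonneg c) _).symm
  mul_le' x y := ciSup_le fun p => (p.1.mul_le x y).trans
    (mul_le_mul (le_ciSup (BoundedRelations.bddAbove r x) p)
      (le_ciSup (BoundedRelations.bddAbove r y) p) (p.1.nonneg y)
      (Real.iSup_nonneg fun q => q.1.nonneg x))
  star_mul_self' x := by
    have h0 : 0 ≤ ⨆ p : {p : CStarSeminorm F // p.Respects r}, p.1 x :=
      Real.iSup_nonneg fun q => q.1.nonneg x
    refine le_antisymm (ciSup_le fun p => ?_) ?_
    · rw [p.1.star_mul_self]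
      have h := le_ciSup (BoundedRelations.bddAbove r x) p
      exact mul_le_mul h h (p.1.nonneg x) h0
    · have hb : BddAbove (Set.range fun p : {p : CStarSeminorm F // p.Respects r} =>
          p.1 (star x * x)) := BoundedRelations.bddAbove r (star x * x)
      have hT : 0 ≤ ⨆ p : {p : CStarSeminorm F // p.Respects r}, p.1 (star x * x) :=
        Real.iSup_nonneg fun q => q.1.nonneg _
      have hle : (⨆ p : {p : CStarSeminorm F // p.Respects r}, p.1 x) ≤
          √(⨆ p : {p : CStarSeminorm F // p.Respects r}, p.1 (star x * x)) := by
        refine ciSup_le fun p => Real.le_sqrt_of_sq_le ?_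
        rw [sq, ← p.1.star_mul_self]
        exact le_ciSup hb p
      exact (mul_self_le_mul_self h0 hle).trans (Real.mul_self_sqrt hT).le

theorem le_maxCStarSeminorm (p : CStarSeminorm F) (hp : p.Respects r) (x : F) :
    p x ≤ maxCStarSeminorm r x :=
  le_ciSup (BoundedRelations.bddAbove r x) ⟨p, hp⟩

theorem maxCStarSeminorm_respects : (maxCStarSeminorm r).Respects r := fun x y hxy =>
  le_antisymm (ciSup_le fun p => (p.2 x y hxy).le) ((maxCStarSeminorm r).nonneg _)

variable [StarModule ℂ F]

/-- The universal unital C⋆-algebra receiving a unital ⋆-homomorphism from the ⋆-algebra `F` for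
which the relations `x = y`, with `r x y`, hold: the separated completion of `F` for the largest
C⋆-seminorm respecting `r`. -/
def UniversalCStarAlgebra : Type _ := (maxCStarSeminorm r).Completion

namespace UniversalCStarAlgebra

instance : CStarAlgebra (UniversalCStarAlgebra r) :=
  inferInstanceAs (CStarAlgebra (maxCStarSeminorm r).Completion)

/-- The canonical ⋆-homomorphism of `F` to the universal C⋆-algebra. -/
def mk : F →⋆ₐ[ℂ] UniversalCStarAlgebra r := (maxCStarSeminorm r).toCompletion

theorem denseRange_mk : DenseRange (mk r) := (maxCStarSeminorm r).denseRange_toCompletion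

theorem mk_eq {x y : F} (h : r x y) : mk r x = mk r y := by
  have h1 : ‖mk r (x - y)‖ = 0 :=
    ((maxCStarSeminorm r).norm_toCompletion _).trans (maxCStarSeminorm_respects r x y h)
  rwa [norm_eq_zero, map_sub, sub_eq_zero] at h1

variable {r} {B : Type*} [CStarAlgebra B]

/-- The C⋆-seminorm defined by a ⋆-homomorphism to a C⋆-algebra. -/
def _root_.CStarSeminorm.ofHom (f : F →⋆ₐ[ℂ] B) : CStarSeminorm F where
  toFun x := ‖f x‖
  map_zero' := by simp
  add_le' x y := by rw [map_add]; exact norm_add_le _ _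
  neg' x := by rw [map_neg, norm_neg]
  smul' c x := by rw [map_smul, norm_smul]
  mul_le' x y := by rw [map_mul]; exact norm_mul_le _ _
  star_mul_self' x := by rw [map_mul, map_star]; exact CStarRing.norm_star_mul_self

/-- The universal property. -/
def lift (f : F →⋆ₐ[ℂ] B) (hf : ∀ x y, r x y → f x = f y) :
    UniversalCStarAlgebra r →⋆ₐ[ℂ] B :=
  (maxCStarSeminorm r).lift f fun x => le_maxCStarSeminorm r (CStarSeminorm.ofHom f)
    (fun x y h => by change ‖f (x - y)‖ = 0; rw [map_sub, hf x y h, sub_self, norm_zero]) x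

theorem lift_mk (f : F →⋆ₐ[ℂ] B) (hf : ∀ x y, r x y → f x = f y) (x : F) :
    lift f hf (mk r x) = f x :=
  (maxCStarSeminorm r).lift_toCompletion f _ x

end UniversalCStarAlgebra

end Enveloping

/-! ### The maximal tensor product -/

section Tensor

variable {A B C D E : Type*} [CStarAlgebra A] [CStarAlgebra B] [CStarAlgebra C] [CStarAlgebra D]
  [CStarAlgebra E]

/-- A C⋆-seminorm is bounded by the norm on the image of a C⋆-algebra. -/
theorem CStarSeminorm.le_norm {F : Type*} [Ring F] [StarRing F] [Algebra ℂ F] [StarModule ℂ F]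
    (p : CStarSeminorm F) (f : A →⋆ₐ[ℂ] F) (a : A) : p (f a) ≤ ‖a‖ := by
  rw [← p.norm_toCompletion]
  exact NonUnitalStarAlgHom.norm_apply_le (p.toCompletion.comp f) a

instance : BoundedRelations (fun _ _ : A ⊗[ℂ] B => False) where
  bounded x := by
    induction x with
    | zero => exact ⟨0, fun p _ => (map_zero p.toSeminorm).le⟩
    | add x y hx hy =>
      obtain ⟨c, hc⟩ := hx
      obtain ⟨d, hd⟩ := hy
      exact ⟨c + d, fun p hp => (map_add_le_add p.toSeminorm x y).trans
        (add_le_add (hc p hp) (hd p hp))⟩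
    | tmul a b =>
      refine ⟨‖a‖ * ‖b‖, fun p _ => ?_⟩
      let f : A →⋆ₐ[ℂ] A ⊗[ℂ] B :=
        { (Algebra.TensorProduct.includeLeft : A →ₐ[ℂ] A ⊗[ℂ] B) with
          map_star' := fun a => by simp }
      let g : B →⋆ₐ[ℂ] A ⊗[ℂ] B :=
        { (Algebra.TensorProduct.includeRight : B →ₐ[ℂ] A ⊗[ℂ] B) with
          map_star' := fun a => by simp }
      have h : a ⊗ₜ[ℂ] b = f a * g b := by
        change _ = (a ⊗ₜ[ℂ] (1 : B)) * ((1 : A) ⊗ₜ[ℂ] b)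
        simp
      rw [h]
      exact (p.mul_le _ _).trans
        (mul_le_mul (p.le_norm f a) (p.le_norm g b) (p.nonneg _) (norm_nonneg a))

variable (A B) in
/-- The maximal C⋆-tensor product: the completion of the algebraic tensor product for the largest
C⋆-seminorm. -/
def MaxTensor : Type _ := UniversalCStarAlgebra (fun _ _ : A ⊗[ℂ] B => False)

namespace MaxTensor

instance : CStarAlgebra (MaxTensor A B) :=
  inferInstanceAs (CStarAlgebra (UniversalCStarAlgebra (fun _ _ : A ⊗[ℂ] B => False)))

/-- The canonical map of the algebraic tensor product. -/
def ofAlgebraic : A ⊗[ℂ] B →⋆ₐ[ℂ] MaxTensor A B := UniversalCStarAlgebra.mk _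

/-- The elementary tensor `a ⊗ b`. -/
def tmul (a : A) (b : B) : MaxTensor A B := ofAlgebraic (a ⊗ₜ[ℂ] b)

theorem denseRange_ofAlgebraic : DenseRange (ofAlgebraic : A ⊗[ℂ] B → MaxTensor A B) :=
  UniversalCStarAlgebra.denseRange_mk _

variable (A B) in
/-- The ⋆-homomorphism `a ↦ a ⊗ 1`. -/
def inl : A →⋆ₐ[ℂ] MaxTensor A B := ofAlgebraic.comp
  { (Algebra.TensorProduct.includeLeft : A →ₐ[ℂ] A ⊗[ℂ] B) with
    map_star' := fun a => by simp }

variable (A B) in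
/-- The ⋆-homomorphism `b ↦ 1 ⊗ b`. -/
def inr : B →⋆ₐ[ℂ] MaxTensor A B := ofAlgebraic.comp
  { (Algebra.TensorProduct.includeRight : B →ₐ[ℂ] A ⊗[ℂ] B) with
    map_star' := fun a => by simp }

theorem inl_apply (a : A) : inl A B a = tmul a 1 := rfl

theorem inr_apply (b : B) : inr A B b = tmul 1 b := rfl

theorem tmul_mul_tmul (a a' : A) (b b' : B) :
    tmul a b * tmul a' b' = tmul (a * a') (b * b') := by
  simp only [tmul, ← map_mul, Algebra.TensorProduct.tmul_mul_tmul]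

theorem commute_inl_inr (a : A) (b : B) : Commute (inl A B a) (inr A B b) := by
  simp only [commute_iff_eq, inl_apply, inr_apply, tmul_mul_tmul, one_mul, mul_one]

/-- The ⋆-homomorphism `a ⊗ b ↦ f a * g b`, for ⋆-homomorphisms `f` and `g` with commuting
ranges. -/
def lift (f : A →⋆ₐ[ℂ] C) (g : B →⋆ₐ[ℂ] C) (h : ∀ a b, Commute (f a) (g b)) :
    MaxTensor A B →⋆ₐ[ℂ] C :=
  UniversalCStarAlgebra.lift
    { Algebra.TensorProduct.lift (f : A →ₐ[ℂ] C) (g : B →ₐ[ℂ] C) h with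
      map_star' := fun x => by
        change Algebra.TensorProduct.lift (f : A →ₐ[ℂ] C) (g : B →ₐ[ℂ] C) h (star x) =
          star (Algebra.TensorProduct.lift (f : A →ₐ[ℂ] C) (g : B →ₐ[ℂ] C) h x)
        induction x with
        | zero => simp
        | add x y hx hy => rw [star_add, map_add, hx, hy, map_add, star_add]
        | tmul a b =>
          rw [TensorProduct.star_tmul, Algebra.TensorProduct.lift_tmul,
            Algebra.TensorProduct.lift_tmul, star_mul]
          change f (star a) * g (star b) = star (g b) * star (f a)
          rw [map_star, map_star]
          exact ((h a b).star_star).eq }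
    fun _ _ h => h.elim

theorem lift_tmul (f : A →⋆ₐ[ℂ] C) (g : B →⋆ₐ[ℂ] C) (h : ∀ a b, Commute (f a) (g b))
    (a : A) (b : B) : lift f g h (tmul a b) = f a * g b :=
  (UniversalCStarAlgebra.lift_mk _ _ _).trans 
    (Algebra.TensorProduct.lift_tmul (f : A →ₐ[ℂ] C) (g : B →ₐ[ℂ] C) h a b)

theorem commute_lift (f : A →⋆ₐ[ℂ] C) (g : B →⋆ₐ[ℂ] C) (h : ∀ a b, Commute (f a) (g b)) (c : C)
    (hf : ∀ a, Commute (f a) c) (hg : ∀ b, Commute (g b) c) (x : MaxTensor A B) :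
    Commute (lift f g h x) c := by
  have hc : Continuous (lift f g h) :=
    AddMonoidHomClass.continuous_of_bound (lift f g h) 1 fun x => by
      rw [one_mul]; exact NonUnitalStarAlgHom.norm_apply_le _ x
  refine denseRange_ofAlgebraic.induction_on x
    (isClosed_eq (hc.mul continuous_const) (continuous_const.mul hc)) fun x => ?_
  induction x with
  | zero => simp
  | add x y hx hy => rw [map_add, map_add]; exact Commute.add_left hx hy
  | tmul a b =>
    change Commute (lift f g h (tmul a b)) c
    rw [lift_tmul]
    exact (hf a).mul_left (hg b)

/-- The tensor product `f ⊗ g` of two ⋆-homomorphisms. -/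
def map (f : A →⋆ₐ[ℂ] C) (g : B →⋆ₐ[ℂ] D) : MaxTensor A B →⋆ₐ[ℂ] MaxTensor C D :=
  lift ((inl C D).comp f) ((inr C D).comp g) fun _ _ => commute_inl_inr _ _

variable (A B C) in
/-- The ⋆-homomorphism `a ⊗ b ↦ a ⊗ (b ⊗ 1)`. -/
def assocLeft : MaxTensor A B →⋆ₐ[ℂ] MaxTensor A (MaxTensor B C) := map (StarAlgHom.id ℂ A) (inl B C)

variable (A B C) in
/-- The ⋆-homomorphism `c ↦ 1 ⊗ (1 ⊗ c)`. -/
def assocRight : C →⋆ₐ[ℂ] MaxTensor A (MaxTensor B C) := (inr A (MaxTensor B C)).comp (inr B C)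

theorem commute_assocRight (b : B) (c : C) :
    Commute (inr A (MaxTensor B C) (inl B C b)) (assocRight A B C c) := by
  have h := congrArg (inr A (MaxTensor B C)) (commute_inl_inr b c).eq
  rw [map_mul, map_mul] at h
  exact h

theorem commute_assocLeft_assocRight (x : MaxTensor A B) (c : C) :
    Commute (assocLeft A B C x) (assocRight A B C c) :=
  commute_lift ((inl A (MaxTensor B C)).comp (StarAlgHom.id ℂ A))
    ((inr A (MaxTensor B C)).comp (inl B C)) (fun _ _ => commute_inl_inr _ _)
    (assocRight A B C c) (fun a => commute_inl_inr a (inr B C c))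
    (fun b => commute_assocRight b c) x

variable (A B C) in
/-- The associativity map `(a ⊗ b) ⊗ c ↦ a ⊗ (b ⊗ c)`. -/
def assoc : MaxTensor (MaxTensor A B) C →⋆ₐ[ℂ] MaxTensor A (MaxTensor B C) :=
  lift (assocLeft A B C) (assocRight A B C) commute_assocLeft_assocRight

end MaxTensor

end Tensor

/-! ### Free ⋆-algebras -/

/-- The free complex unital ⋆-algebra on the set `G`: the free algebra on the elements of `G` and
their adjoints. -/
def FreeStarAlgebra (G : Type*) : Type _ := FreeAlgebra ℂ (G ⊕ G)

namespace FreeStarAlgebra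

variable {G : Type*}

instance : Ring (FreeStarAlgebra G) := inferInstanceAs (Ring (FreeAlgebra ℂ (G ⊕ G)))
instance : Algebra ℂ (FreeStarAlgebra G) :=
  inferInstanceAs (Algebra ℂ (FreeAlgebra ℂ (G ⊕ G)))

/-- The generator `g`, for `Sum.inl g`, and the adjoint of the generator `g`, for `Sum.inr g`. -/
def letter (x : G ⊕ G) : FreeStarAlgebra G := FreeAlgebra.ι ℂ x

/-- The generator `g`. -/
def gen (g : G) : FreeStarAlgebra G := letter (Sum.inl g)

variable (G) in
/-- The opposite algebra with the complex conjugate scalar multiplication. -/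
abbrev conjAlgebra : Algebra ℂ (FreeStarAlgebra G)ᵐᵒᵖ :=
  ((algebraMap ℂ (FreeStarAlgebra G)ᵐᵒᵖ).comp (starRingEnd ℂ)).toAlgebra'
    fun c x => Algebra.commutes (starRingEnd ℂ c) x

variable (G) in
/-- The adjoint, as a conjugate linear ring homomorphism to the opposite algebra that exchanges
the generators with their adjoints. -/
def starHom : FreeStarAlgebra G →+* (FreeStarAlgebra G)ᵐᵒᵖ :=
  letI := conjAlgebra G
  (FreeAlgebra.lift ℂ fun x : G ⊕ G => MulOpposite.op (letter x.swap)).toRingHom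

theorem starHom_letter (x : G ⊕ G) : starHom G (letter x) = MulOpposite.op (letter x.swap) :=
  let _ := conjAlgebra G
  FreeAlgebra.lift_ι_apply (R := ℂ) (fun x : G ⊕ G => MulOpposite.op (letter x.swap)) x

theorem starHom_algebraMap (c : ℂ) :
    starHom G (algebraMap ℂ _ c) =
      MulOpposite.op (algebraMap ℂ (FreeStarAlgebra G) (starRingEnd ℂ c)) :=
  let _ := conjAlgebra G
  (FreeAlgebra.lift ℂ fun x : G ⊕ G => MulOpposite.op (letter x.swap)).commutes' c

theorem induction {P : FreeStarAlgebra G → Prop} (h_const : ∀ c, P (algebraMap ℂ _ c))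
    (h_gen : ∀ x : G ⊕ G, P (letter x)) (h_mul : ∀ x y, P x → P y → P (x * y))
    (h_add : ∀ x y, P x → P y → P (x + y)) (x : FreeStarAlgebra G) : P x :=
  FreeAlgebra.induction ℂ (G ⊕ G) h_const h_gen h_mul h_add x

instance : Star (FreeStarAlgebra G) := ⟨fun x => (starHom G x).unop⟩

theorem star_def (x : FreeStarAlgebra G) : star x = (starHom G x).unop := rfl

theorem star_algebraMap (c : ℂ) :
    star (algebraMap ℂ (FreeStarAlgebra G) c) = algebraMap ℂ _ (starRingEnd ℂ c) := by
  rw [star_def, starHom_algebraMap, MulOpposite.unop_op]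

theorem star_letter (x : G ⊕ G) : star (letter x) = letter x.swap := by
  rw [star_def, starHom_letter, MulOpposite.unop_op]

instance : StarRing (FreeStarAlgebra G) where
  star_mul x y := by simp only [star_def, map_mul, MulOpposite.unop_mul]
  star_add x y := by simp only [star_def, map_add, MulOpposite.unop_add]
  star_involutive x := by
    induction x using FreeStarAlgebra.induction with
    | h_const c => rw [star_algebraMap, star_algebraMap, Complex.conj_conj]
    | h_gen x => rw [star_letter, star_letter, Sum.swap_swap]
    | h_mul x y hx hy =>
      simp only [star_def, map_mul, MulOpposite.unop_mul] at hx hy ⊢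
      rw [hx, hy]
    | h_add x y hx hy =>
      simp only [star_def, map_add, MulOpposite.unop_add] at hx hy ⊢
      rw [hx, hy]

instance : StarModule ℂ (FreeStarAlgebra G) where
  star_smul c x := by
    rw [Algebra.smul_def, Algebra.smul_def, star_mul, star_algebraMap]
    exact (Algebra.commutes _ _).symm

/-- Relations that bound the generators bound all elements. -/
theorem boundedRelations (r : FreeStarAlgebra G → FreeStarAlgebra G → Prop)
    (h : ∀ g, ∃ C, ∀ p : CStarSeminorm (FreeStarAlgebra G), p.Respects r → p (gen g) ≤ C) :
    BoundedRelations r where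
  bounded x := by
    induction x using FreeStarAlgebra.induction with
    | h_const c =>
      refine ⟨‖c‖ * 1, fun p _ => ?_⟩
      rw [Algebra.algebraMap_eq_smul_one, map_smul_eq_mul p.toSeminorm]
      refine mul_le_mul_of_nonneg_left ?_ (norm_nonneg c)
      have h1 := p.star_mul_self 1
      rw [star_one, one_mul] at h1
      nlinarith [p.nonneg 1]
    | h_gen x =>
      rcases x with g | g
      · exact h g
      · obtain ⟨C, hC⟩ := h g
        refine ⟨C, fun p hp => ?_⟩
        have h1 : letter (Sum.inr g) = star (gen g) :=
          (star_letter (Sum.inl g)).symm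
        rw [h1, p.star_eq]
        exact hC p hp
    | h_mul x y hx hy =>
      obtain ⟨c, hc⟩ := hx
      obtain ⟨d, hd⟩ := hy
      exact ⟨c * d, fun p hp => (p.mul_le x y).trans (mul_le_mul (hc p hp) (hd p hp)
        (p.nonneg y) ((p.nonneg x).trans (hc p hp)))⟩
    | h_add x y hx hy =>
      obtain ⟨c, hc⟩ := hx
      obtain ⟨d, hd⟩ := hy
      exact ⟨c + d, fun p hp => (map_add_le_add p.toSeminorm x y).trans
        (add_le_add (hc p hp) (hd p hp))⟩

end FreeStarAlgebra

theorem CStarSeminorm.Respects.toCompletion_eq {F : Type*} [Ring F] [StarRing F] [Algebra ℂ F]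
    {p : CStarSeminorm F} {r : F → F → Prop} (hp : p.Respects r) {x y : F} (h : r x y) :
    p.toCompletion x = p.toCompletion y := by
  have h1 : ‖p.toCompletion (x - y)‖ = 0 := (p.norm_toCompletion _).trans (hp x y h)
  rwa [norm_eq_zero, map_sub, sub_eq_zero] at h1

/-! ### Magic unitaries and Hopf C⋆-algebras -/

/-- A magic unitary: a square matrix whose entries are projections, and whose rows and columns are
partitions of unity, that is, consist of pairwise orthogonal projections of sum `1`. -/
structure IsMagicUnitary {I A : Type*} [Fintype I] [Ring A] [StarRing A] (u : Matrix I I A) :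
    Prop where
  isStarProjection : ∀ i j, IsStarProjection (u i j)
  row_orthogonal : ∀ i j k, j ≠ k → u i j * u i k = 0
  col_orthogonal : ∀ i j k, i ≠ j → u i k * u j k = 0
  row_sum : ∀ i, ∑ j, u i j = 1
  col_sum : ∀ j, ∑ i, u i j = 1

/-- The linear map `a ⊗ b ↦ S a * b` on the algebraic tensor product. -/
def antipodeMul {A : Type*} [CStarAlgebra A] (S : A →⋆ₐ[ℂ] Aᵐᵒᵖ) : A ⊗[ℂ] A →ₗ[ℂ] A :=
  LinearMap.mul' ℂ A ∘ₗ
    TensorProduct.map ((MulOpposite.opLinearEquiv ℂ).symm.toLinearMap ∘ₗ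
      ((S : A →ₐ[ℂ] Aᵐᵒᵖ) : A →ₗ[ℂ] Aᵐᵒᵖ)) LinearMap.id

/-- The linear map `a ⊗ b ↦ a * S b` on the algebraic tensor product. -/
def mulAntipode {A : Type*} [CStarAlgebra A] (S : A →⋆ₐ[ℂ] Aᵐᵒᵖ) : A ⊗[ℂ] A →ₗ[ℂ] A :=
  LinearMap.mul' ℂ A ∘ₗ
    TensorProduct.map LinearMap.id ((MulOpposite.opLinearEquiv ℂ).symm.toLinearMap ∘ₗ
      ((S : A →ₐ[ℂ] Aᵐᵒᵖ) : A →ₗ[ℂ] Aᵐᵒᵖ))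

/-- A Hopf C⋆-algebra structure (universal, of Kac type) on the unital C⋆-algebra `A`.

The tensor product is the maximal one. As it maps onto the spatial one, functorially, the structure
and its axioms pass to the spatial tensor product.

The multiplication `a ⊗ b ↦ a * b` is defined on the algebraic tensor product, and not on the
C⋆-tensor product. So, as usual, the antipode axiom is required on a dense ⋆-subalgebra `A₀` which
`Δ` maps to the algebraic tensor product `A₀ ⊗ A₀` and `S` maps to `A₀`; it is a Hopf ⋆-algebra. -/
structure HopfCStarStructure (A : Type*) [CStarAlgebra A] where
  /-- The comultiplication `Δ : A → A ⊗ A`. -/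
  comul : A →⋆ₐ[ℂ] MaxTensor A A
  /-- The counit `ε : A → ℂ`. -/
  counit : A →⋆ₐ[ℂ] ℂ
  /-- The antipode `S : A → Aᵒᵖ`. -/
  antipode : A →⋆ₐ[ℂ] Aᵐᵒᵖ
  coassoc : ((MaxTensor.assoc A A A).comp (MaxTensor.map comul (StarAlgHom.id ℂ A))).comp comul =
    (MaxTensor.map (StarAlgHom.id ℂ A) comul).comp comul
  counit_comul : (MaxTensor.lift ((StarAlgHom.ofId ℂ A).comp counit) (StarAlgHom.id ℂ A)
    fun _ _ => Algebra.commutes _ _).comp comul = StarAlgHom.id ℂ A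
  comul_counit : (MaxTensor.lift (StarAlgHom.id ℂ A) ((StarAlgHom.ofId ℂ A).comp counit)
    fun _ _ => (Algebra.commutes _ _).symm).comp comul = StarAlgHom.id ℂ A
  antipode_antipode : ∀ a, (antipode (antipode a).unop).unop = a
  exists_dense_hopf : ∃ A₀ : StarSubalgebra ℂ A, Dense (A₀ : Set A) ∧
    (∀ a ∈ A₀, (antipode a).unop ∈ A₀) ∧
    ∀ a ∈ A₀, ∃ t ∈ LinearMap.range (TensorProduct.map A₀.subtype.toLinearMap
        A₀.subtype.toLinearMap),
      MaxTensor.ofAlgebraic t = comul a ∧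
      antipodeMul antipode t = algebraMap ℂ A (counit a) ∧
      mulAntipode antipode t = algebraMap ℂ A (counit a)

namespace HopfCStarStructure

variable {A B : Type*} [CStarAlgebra A] [CStarAlgebra B]

open Classical in
/-- `u` is a multiplicative magic unitary, whose adjoint is given by the antipode. -/
structure IsFundamental {I : Type*} [Fintype I] (H : HopfCStarStructure A) (u : Matrix I I A) :
    Prop where
  isMagicUnitary : IsMagicUnitary u
  comul_apply : ∀ i j, H.comul (u i j) = ∑ k, MaxTensor.tmul (u i k) (u k j)
  counit_apply : ∀ i j, H.counit (u i j) = if i = j then 1 else 0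
  antipode_apply : ∀ i j, H.antipode (u i j) = MulOpposite.op (u j i)

/-- `φ` is a morphism of Hopf C⋆-algebras. -/
structure IsHopfHom (H : HopfCStarStructure A) (K : HopfCStarStructure B) (φ : A →⋆ₐ[ℂ] B) :
    Prop where
  map_comul : ∀ a, K.comul (φ a) = MaxTensor.map φ φ (H.comul a)
  map_counit : ∀ a, K.counit (φ a) = H.counit a
  map_antipode : ∀ a, (K.antipode (φ a)).unop = φ (H.antipode a).unop

end HopfCStarStructure

/-! ### The C⋆-algebra of the quantum automorphism group of a graph -/

section Graph

variable {V W : Type*}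

/-- The lexicographic product: a copy of `X` at each vertex of `Y`. -/
def lexProduct (X : SimpleGraph V) (Y : SimpleGraph W) : SimpleGraph (V × W) where
  Adj x y := Y.Adj x.2 y.2 ∨ (x.2 = y.2 ∧ X.Adj x.1 y.1)
  symm := ⟨fun _ _ h => h.imp (fun h => h.symm) fun h => ⟨h.1.symm, h.2.symm⟩⟩
  loopless := ⟨fun _ h => h.elim (fun h => h.ne rfl) fun h => h.2.ne rfl⟩

open Classical in
/-- The adjacency matrix of `X`, with entries in the ring `R`. -/
def adjacency (X : SimpleGraph V) (R : Type*) [Zero R] [One R] : Matrix V V R :=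
  Matrix.of fun i j => if X.Adj i j then 1 else 0

variable (V) in
/-- The square matrix of free generators. -/
def generators : Matrix V V (FreeStarAlgebra (V × V)) :=
  Matrix.of fun i j => FreeStarAlgebra.gen (i, j)

open FreeStarAlgebra in
/-- The relations between generators `u i j` that make `u` a magic unitary commuting with the
adjacency matrix of `X`. -/
inductive QAutRel [Fintype V] (X : SimpleGraph V) :
    FreeStarAlgebra (V × V) → FreeStarAlgebra (V × V) → Prop
  | star (i j : V) : QAutRel X (star (gen (i, j))) (gen (i, j))
  | idem (i j : V) : QAutRel X (gen (i, j) * gen (i, j)) (gen (i, j))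
  | row_orthogonal (i j k : V) : j ≠ k → QAutRel X (gen (i, j) * gen (i, k)) 0
  | col_orthogonal (i j k : V) : i ≠ j → QAutRel X (gen (i, k) * gen (j, k)) 0
  | row_sum (i : V) : QAutRel X (∑ j, gen (i, j)) 1
  | col_sum (j : V) : QAutRel X (∑ i, gen (i, j)) 1
  | comm (i j : V) : QAutRel X
      ((adjacency X (FreeStarAlgebra (V × V)) * generators V : Matrix V V _) i j)
      ((generators V * adjacency X (FreeStarAlgebra (V × V)) : Matrix V V _) i j)

variable [Fintype V]

instance (X : SimpleGraph V) : BoundedRelations (QAutRel X) :=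
  FreeStarAlgebra.boundedRelations _ fun ⟨i, j⟩ => ⟨1, fun p hp => by
    have h1 := hp.toCompletion_eq (QAutRel.star (X := X) i j)
    have h2 := hp.toCompletion_eq (QAutRel.idem (X := X) i j)
    rw [map_star] at h1
    rw [map_mul] at h2
    rw [← p.norm_toCompletion]
    have h3 := CStarRing.norm_star_mul_self (x := p.toCompletion (FreeStarAlgebra.gen (i, j)))
    rw [h1, h2] at h3
    nlinarith [norm_nonneg (p.toCompletion (FreeStarAlgebra.gen (i, j)))]⟩

/-- The C⋆-algebra `A(X)` of the graph `X`, that is, the quotient of Wang's universal C⋆-algebra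
of a magic unitary `u`, indexed by the vertices of `X`, by the relations `d u = u d`. -/
def QAut (X : SimpleGraph V) : Type _ := UniversalCStarAlgebra (QAutRel X)

instance (X : SimpleGraph V) : CStarAlgebra (QAut X) :=
  inferInstanceAs (CStarAlgebra (UniversalCStarAlgebra (QAutRel X)))

/-- The universal magic unitary of `A(X)`. -/
def QAut.magic (X : SimpleGraph V) : Matrix V V (QAut X) :=
  (generators V).map (UniversalCStarAlgebra.mk (QAutRel X))

end Graph

/-! ### Free wreath products -/

section FreeWreath

variable {A B I J : Type*} [CStarAlgebra A] [CStarAlgebra B]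

open FreeStarAlgebra in
/-- The relations of the free wreath product, between generators `x⁽ᵃ⁾` (for `x` in `A` and `a` in
`J`) and generators `y` in `B`: for each `a`, the map `x ↦ x⁽ᵃ⁾` is a unital ⋆-homomorphism, so is
the map `y ↦ y`, and `u i j⁽ᵃ⁾` commutes with `v a b`. -/
inductive FreeWreathRel (u : Matrix I I A) (v : Matrix J J B) :
    FreeStarAlgebra ((J × A) ⊕ B) → FreeStarAlgebra ((J × A) ⊕ B) → Prop
  | left_one (a : J) : FreeWreathRel u v (gen (.inl (a, 1))) 1
  | left_mul (a : J) (x y : A) : FreeWreathRel u v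
      (gen (.inl (a, x * y))) (gen (.inl (a, x)) * gen (.inl (a, y)))
  | left_add (a : J) (x y : A) : FreeWreathRel u v
      (gen (.inl (a, x + y))) (gen (.inl (a, x)) + gen (.inl (a, y)))
  | left_smul (a : J) (c : ℂ) (x : A) : FreeWreathRel u v
      (gen (.inl (a, c • x))) (c • gen (.inl (a, x)))
  | left_star (a : J) (x : A) : FreeWreathRel u v
      (gen (.inl (a, star x))) (star (gen (.inl (a, x))))
  | right_one : FreeWreathRel u v (gen (.inr 1)) 1
  | right_mul (x y : B) : FreeWreathRel u v (gen (.inr (x * y))) (gen (.inr x) * gen (.inr y))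
  | right_add (x y : B) : FreeWreathRel u v (gen (.inr (x + y))) (gen (.inr x) + gen (.inr y))
  | right_smul (c : ℂ) (x : B) : FreeWreathRel u v (gen (.inr (c • x))) (c • gen (.inr x))
  | right_star (x : B) : FreeWreathRel u v (gen (.inr (star x))) (star (gen (.inr x)))
  | comm (i j : I) (a b : J) : FreeWreathRel u v
      (gen (.inl (a, u i j)) * gen (.inr (v a b))) (gen (.inr (v a b)) * gen (.inl (a, u i j)))

variable (u : Matrix I I A) (v : Matrix J J B)

/-- A map to a C⋆-algebra that is multiplicative, unital, linear and ⋆-preserving. -/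
def starAlgHomOfMap {C : Type*} [CStarAlgebra C] (f : A → C) (h1 : f 1 = 1)
    (hm : ∀ x y, f (x * y) = f x * f y) (ha : ∀ x y, f (x + y) = f x + f y)
    (hs : ∀ (c : ℂ) x, f (c • x) = c • f x) (hst : ∀ x, f (star x) = star (f x)) :
    A →⋆ₐ[ℂ] C where
  toFun := f
  map_one' := h1
  map_mul' := hm
  map_zero' := by simpa using hs 0 0
  map_add' := ha
  commutes' c := by rw [Algebra.algebraMap_eq_smul_one, hs, h1, Algebra.algebraMap_eq_smul_one]
  map_star' := hst

open FreeStarAlgebra in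
instance : BoundedRelations (FreeWreathRel u v) :=
  boundedRelations _ fun g => by
    rcases g with ⟨a, x⟩ | x
    · refine ⟨‖x‖, fun p hp => ?_⟩
      rw [← p.norm_toCompletion]
      exact NonUnitalStarAlgHom.norm_apply_le (starAlgHomOfMap
        (fun x => p.toCompletion (gen (.inl (a, x))))
        ((hp.toCompletion_eq (.left_one a)).trans (map_one _))
        (fun x y => (hp.toCompletion_eq (.left_mul a x y)).trans (map_mul _ _ _))
        (fun x y => (hp.toCompletion_eq (.left_add a x y)).trans (map_add _ _ _))
        (fun c x => (hp.toCompletion_eq (.left_smul a c x)).trans (map_smul _ _ _))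
        (fun x => (hp.toCompletion_eq (.left_star a x)).trans (map_star _ _))) x
    · refine ⟨‖x‖, fun p hp => ?_⟩
      rw [← p.norm_toCompletion]
      exact NonUnitalStarAlgHom.norm_apply_le (starAlgHomOfMap
        (fun x => p.toCompletion (gen (.inr x)))
        ((hp.toCompletion_eq .right_one).trans (map_one _))
        (fun x y => (hp.toCompletion_eq (.right_mul x y)).trans (map_mul _ _ _))
        (fun x y => (hp.toCompletion_eq (.right_add x y)).trans (map_add _ _ _))
        (fun c x => (hp.toCompletion_eq (.right_smul c x)).trans (map_smul _ _ _))
        (fun x => (hp.toCompletion_eq (.right_star x)).trans (map_star _ _))) x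

/-- The free wreath product of `(A, u)` and `(B, v)`: the quotient, by the relations
`[u i j⁽ᵃ⁾, v a b] = 0`, of the unital free product of `B` and of copies of `A` indexed by `J`. -/
def FreeWreath : Type _ := UniversalCStarAlgebra (FreeWreathRel u v)

instance : CStarAlgebra (FreeWreath u v) :=
  inferInstanceAs (CStarAlgebra (UniversalCStarAlgebra (FreeWreathRel u v)))

namespace FreeWreath

/-- The canonical ⋆-homomorphism `x ↦ x⁽ᵃ⁾`. -/
def left (a : J) : A →⋆ₐ[ℂ] FreeWreath u v :=
  starAlgHomOfMap (fun x => UniversalCStarAlgebra.mk (FreeWreathRel u v)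
      (FreeStarAlgebra.gen (.inl (a, x))))
    ((UniversalCStarAlgebra.mk_eq _ (.left_one a)).trans (map_one _))
    (fun x y => (UniversalCStarAlgebra.mk_eq _ (.left_mul a x y)).trans (map_mul _ _ _))
    (fun x y => (UniversalCStarAlgebra.mk_eq _ (.left_add a x y)).trans (map_add _ _ _))
    (fun c x => (UniversalCStarAlgebra.mk_eq _ (.left_smul a c x)).trans (map_smul _ _ _))
    (fun x => (UniversalCStarAlgebra.mk_eq _ (.left_star a x)).trans (map_star _ _))

/-- The canonical ⋆-homomorphism of `B`. -/
def right : B →⋆ₐ[ℂ] FreeWreath u v :=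
  starAlgHomOfMap (fun x => UniversalCStarAlgebra.mk (FreeWreathRel u v)
      (FreeStarAlgebra.gen (.inr x)))
    ((UniversalCStarAlgebra.mk_eq _ .right_one).trans (map_one _))
    (fun x y => (UniversalCStarAlgebra.mk_eq _ (.right_mul x y)).trans (map_mul _ _ _))
    (fun x y => (UniversalCStarAlgebra.mk_eq _ (.right_add x y)).trans (map_add _ _ _))
    (fun c x => (UniversalCStarAlgebra.mk_eq _ (.right_smul c x)).trans (map_smul _ _ _))
    (fun x => (UniversalCStarAlgebra.mk_eq _ (.right_star x)).trans (map_star _ _))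

/-- The magic unitary `w` of the free wreath product, with entries
`w (i, a) (j, b) = u i j⁽ᵃ⁾ * v a b`. -/
def magic : Matrix (I × J) (I × J) (FreeWreath u v) :=
  Matrix.of fun x y => left u v x.2 (u x.1 y.1) * right u v (v x.2 y.2)

end FreeWreath

end FreeWreath

end

noncomputable section

/-! ### ⋆-homomorphisms with dense range are surjective -/

section Surjective

variable {A B : Type*} [CStarAlgebra A] [CStarAlgebra B]

/-! Everything follows from the universal properties. The adjacency matrix of X∘Y splits as 𝟙⊗d_Y +
d_X⊗1, where 𝟙 is the all-ones matrix. The matrix w commutes with the first summand because rows and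
columns of each u⁽ᵃ⁾ sum to 1, and with the second because each u⁽ᵃ⁾ commutes with d_X
(`IsQAutMatrix.wreath`). As w is also a magic unitary, the universal property of A(X∘Y) yields φ.
Summing w over one index gives back all u⁽ᵃ⁾ᵢⱼ and, X being nonempty, all v_ab. So the entries of w
generate, φ has dense range, and a ⋆-homomorphism of C⋆-algebras with dense range is onto
(`StarAlgHom.surjective_of_denseRange`). Compatibility with Δ, ε and S needs checking only on the
generating entries (`IsFundamental.isHopfHom`).

For the Hopf structures, `IsMagicUnitary.existsUnique_hopf` reduces all axioms to the existence of
⋆-homomorphisms Δ, ε, S with the prescribed values on a generating magic unitary. For A(X) these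
come from the matrices (u⊗1)(1⊗u), the identity and the transpose of u over the opposite algebra.

For the free wreath product, the values on u⁽ᵃ⁾ᵢⱼ = ∑_b w_{ia,jb} are forced: Δ(u⁽ᵃ⁾ᵢⱼ) = ∑_c
(v_ac⊗1) ∑_k u⁽ᵃ⁾ᵢₖ⊗u⁽ᶜ⁾ₖⱼ and S(u⁽ᵃ⁾ᵢⱼ) = ∑_c u⁽ᶜ⁾ⱼᵢ v_ca. These matrices are glued from magic
unitaries along a partition of unity commuting with them (`IsMagicUnitary.glue`,
`IsQAutMatrix.glue`), hence again satisfy the relations of A(X). The wreath relations hold for the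
images because a product of two projections that is self-adjoint is a product of commuting
projections. -/

theorem StarAlgHom.continuous_cstar (φ : A →⋆ₐ[ℂ] B) : Continuous φ :=
  AddMonoidHomClass.continuous_of_bound φ 1 fun x => by
    rw [one_mul]; exact NonUnitalStarAlgHom.norm_apply_le φ x

/-- A self-adjoint element of the range of a ⋆-homomorphism has a preimage that is not larger. -/
theorem IsSelfAdjoint.exists_preimage_norm_le (φ : A →⋆ₐ[ℂ] B) {a : A} (ha : IsSelfAdjoint a) :
    ∃ x, φ x = φ a ∧ ‖x‖ ≤ ‖φ a‖ := by
  -- Truncation to [-‖φ a‖, ‖φ a‖], applied to `a` by functional calculus. It fixes the spectrum of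
  -- `φ a`, so `f(a)` still maps to `φ a`, and its values bound the norm of `f(a)`.
  let f : ℝ → ℝ := fun t => max (-‖φ a‖) (min t ‖φ a‖)
  have hf : Continuous f := by fun_prop
  have hb : IsSelfAdjoint (φ a) := ha.map φ
  refine ⟨cfc f a, ?_, norm_cfc_le (norm_nonneg _) fun t _ => ?_⟩
  · rw [StarAlgHomClass.map_cfc (S := ℂ) φ f a hf.continuousOn φ.continuous_cstar ha hb]
    cases subsingleton_or_nontrivial B
    · exact Subsingleton.elim _ _
    refine (cfc_congr fun t ht => ?_).trans (cfc_id ℝ (φ a))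
    have h := abs_le.mp (spectrum.norm_le_norm_of_mem ht)
    simp only [f, id, min_eq_left h.2, max_eq_right h.1]
  · rw [Real.norm_eq_abs, abs_le]
    exact ⟨le_max_left _ _, max_le (by linarith [norm_nonneg (φ a)]) (min_le_right _ _)⟩

/-- The factor 2 comes from lifting real and imaginary parts separately. Any constant independent of
`a` would serve for the closed range argument. -/
theorem StarAlgHom.exists_preimage_norm_le (φ : A →⋆ₐ[ℂ] B) (a : A) :
    ∃ x, φ x = φ a ∧ ‖x‖ ≤ 2 * ‖φ a‖ := by
  obtain ⟨x, hx, hx'⟩ := (realPart a).2.exists_preimage_norm_le φ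
  obtain ⟨y, hy, hy'⟩ := (imaginaryPart a).2.exists_preimage_norm_le φ
  have hr : φ (realPart a : A) = (realPart (φ a) : B) := by
    rw [realPart_apply_coe, realPart_apply_coe, ← Complex.coe_smul, ← Complex.coe_smul, map_smul,
      map_add, map_star]
  have hi : φ (imaginaryPart a : A) = (imaginaryPart (φ a) : B) := by
    rw [imaginaryPart_apply_coe, imaginaryPart_apply_coe, ← Complex.coe_smul, ← Complex.coe_smul,
      map_smul, map_smul, map_sub, map_star]
  refine ⟨x + Complex.I • y, ?_, ?_⟩
  · rw [map_add, map_smul, hx, hy, ← map_smul, ← map_add, realPart_add_I_smul_imaginaryPart]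
  · rw [hr] at hx'
    rw [hi] at hy'
    have h1 := realPart.norm_le (φ a)
    have h2 := imaginaryPart.norm_le (φ a)
    refine (norm_add_le _ _).trans ?_
    rw [norm_smul, Complex.norm_I, one_mul]
    have h3 : ‖(realPart (φ a) : B)‖ ≤ ‖φ a‖ := h1
    have h4 : ‖(imaginaryPart (φ a) : B)‖ ≤ ‖φ a‖ := h2
    linarith

/-- An element of the closure of the range is a rapidly convergent series of elements of the range.
Preimages of controlled norm make the lifted series converge in the complete space `A`, so the range
is closed. -/
theorem StarAlgHom.surjective_of_denseRange (φ : A →⋆ₐ[ℂ] B) (h : DenseRange φ) :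
    Function.Surjective φ := by
  let g : NormedAddGroupHom A B :=
    { toFun := φ
      map_add' := map_add φ
      bound' := ⟨1, fun x => by rw [one_mul]; exact NonUnitalStarAlgHom.norm_apply_le φ x⟩ }
  have hg : g.SurjectiveOnWith g.range 2 := by
    rintro _ ⟨a, rfl⟩
    exact φ.exists_preimage_norm_le a
  intro b
  obtain ⟨x, hx, -⟩ := controlled_closure_of_complete two_pos one_pos hg b (h b)
  exact ⟨x, hx⟩

end Surjective

/-! ### Matrices whose entries generate a C⋆-algebra -/

section Generation

variable {A C I : Type*} [CStarAlgebra A] [CStarAlgebra C]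

/-- The set of entries of a matrix. -/
def Matrix.entries (z : Matrix I I A) : Set A := {x | ∃ i j, z i j = x}

theorem Matrix.mem_adjoin_entries (z : Matrix I I A) (i j : I) :
    z i j ∈ Algebra.adjoin ℂ z.entries := Algebra.subset_adjoin ⟨i, j, rfl⟩

/-- The entries of `z` generate a dense subalgebra. -/
def Matrix.Generates (z : Matrix I I A) : Prop := Dense (Algebra.adjoin ℂ z.entries : Set A)

variable {z : Matrix I I A}

/-- No case for adjoints is needed, since density is required of the plain subalgebra. For a magic
unitary nothing is lost: its entries are self-adjoint. -/
theorem Matrix.Generates.induction (hz : z.Generates) {P : A → Prop} (closed : IsClosed {a | P a})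
    (entry : ∀ i j, P (z i j)) (const : ∀ c, P (algebraMap ℂ A c))
    (add : ∀ x y, P x → P y → P (x + y)) (mul : ∀ x y, P x → P y → P (x * y)) (a : A) : P a := by
  have h : closure (Algebra.adjoin ℂ z.entries : Set A) ⊆ {a | P a} :=
    closure_minimal (fun x hx => Algebra.adjoin_induction
      (by rintro _ ⟨i, j, rfl⟩; exact entry i j) const (fun x y _ _ => add x y)
      (fun x y _ _ => mul x y) hx) closed
  exact h (hz a)

theorem Matrix.Generates.mem (hz : z.Generates) (S : Subalgebra ℂ A) (closed : IsClosed (S : Set A))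
    (entry : ∀ i j, z i j ∈ S) (a : A) : a ∈ S :=
  hz.induction closed entry S.algebraMap_mem (fun _ _ => S.add_mem) (fun _ _ => S.mul_mem) a

theorem Matrix.Generates.hom_ext (hz : z.Generates) {f g : A →⋆ₐ[ℂ] C}
    (h : ∀ i j, f (z i j) = g (z i j)) : f = g := by
  ext a
  refine hz.induction (P := fun a => f a = g a)
    (isClosed_eq f.continuous_cstar g.continuous_cstar) h (fun c => ?_) (fun x y hx hy => ?_)
    (fun x y hx hy => ?_) a
  · exact (AlgHomClass.commutes f c).trans (AlgHomClass.commutes g c).symm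
  · rw [map_add, map_add, hx, hy]
  · rw [map_mul, map_mul, hx, hy]

theorem Matrix.Generates.surjective {J : Type*} {y : Matrix J J C} (hy : y.Generates)
    (f : A →⋆ₐ[ℂ] C) (h : ∀ i j, y i j ∈ Set.range f) : Function.Surjective f := by
  refine f.surjective_of_denseRange (hy.mono ?_)
  have h1 : Algebra.adjoin ℂ y.entries ≤ (f : A →ₐ[ℂ] C).range :=
    Algebra.adjoin_le (by rintro _ ⟨i, j, rfl⟩; exact h i j)
  exact h1

end Generation

/-! ### Hopf C⋆-algebra structures defined on generators -/

section Hopf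

variable {A B : Type*} [CStarAlgebra A] [CStarAlgebra B]

theorem antipodeMul_tmul (S : A →⋆ₐ[ℂ] Aᵐᵒᵖ) (a b : A) :
    antipodeMul S (a ⊗ₜ b) = (S a).unop * b := rfl

theorem mulAntipode_tmul (S : A →⋆ₐ[ℂ] Aᵐᵒᵖ) (a b : A) :
    mulAntipode S (a ⊗ₜ b) = a * (S b).unop := rfl

/-- As `S` reverses products, S(ac)bd = S(c)·(S(a)b)·d, so the contribution of `s` sits in the
middle. Once that is a scalar it can be pulled out, which makes the antipode axiom stable under
products. -/
theorem antipodeMul_mul_tmul (S : A →⋆ₐ[ℂ] Aᵐᵒᵖ) (s : A ⊗[ℂ] A) (c d : A) :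
    antipodeMul S (s * c ⊗ₜ d) = (S c).unop * antipodeMul S s * d := by
  induction s with
  | zero => simp
  | add x y hx hy => rw [add_mul, map_add, hx, hy, map_add, mul_add, add_mul]
  | tmul a b =>
    rw [Algebra.TensorProduct.tmul_mul_tmul, antipodeMul_tmul, antipodeMul_tmul, map_mul,
      MulOpposite.unop_mul]
    simp only [mul_assoc]

/-- Mirror image of the previous case: in ac·S(bd) = a·(c S(d))·S(b) the right factor is now in the
middle. -/
theorem mulAntipode_tmul_mul (S : A →⋆ₐ[ℂ] Aᵐᵒᵖ) (a b : A) (t : A ⊗[ℂ] A) :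
    mulAntipode S (a ⊗ₜ b * t) = a * mulAntipode S t * (S b).unop := by
  induction t with
  | zero => simp
  | add x y hx hy => rw [mul_add, map_add, hx, hy, map_add, mul_add, add_mul]
  | tmul c d =>
    rw [Algebra.TensorProduct.tmul_mul_tmul, mulAntipode_tmul, mulAntipode_tmul, map_mul,
      MulOpposite.unop_mul]
    simp only [mul_assoc]

theorem antipodeMul_mul (S : A →⋆ₐ[ℂ] Aᵐᵒᵖ) {s : A ⊗[ℂ] A} {c : ℂ}
    (hs : antipodeMul S s = algebraMap ℂ A c) (t : A ⊗[ℂ] A) :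
    antipodeMul S (s * t) = c • antipodeMul S t := by
  induction t with
  | zero => simp
  | add x y hx hy => rw [mul_add, map_add, hx, hy, map_add, smul_add]
  | tmul a b =>
    rw [antipodeMul_mul_tmul, hs, antipodeMul_tmul, ← Algebra.commutes, Algebra.smul_def, mul_assoc]

theorem mulAntipode_mul (S : A →⋆ₐ[ℂ] Aᵐᵒᵖ) (s : A ⊗[ℂ] A) {t : A ⊗[ℂ] A} {c : ℂ}
    (ht : mulAntipode S t = algebraMap ℂ A c) :
    mulAntipode S (s * t) = c • mulAntipode S s := by
  induction s with
  | zero => simp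
  | add x y hx hy => rw [add_mul, map_add, hx, hy, map_add, smul_add]
  | tmul a b =>
    rw [mulAntipode_tmul_mul, ht, mulAntipode_tmul, ← Algebra.commutes, Algebra.smul_def, mul_assoc]

theorem MaxTensor.map_tmul {C D : Type*} [CStarAlgebra C] [CStarAlgebra D] (f : A →⋆ₐ[ℂ] C)
    (g : B →⋆ₐ[ℂ] D) (a : A) (b : B) :
    MaxTensor.map f g (MaxTensor.tmul a b) = MaxTensor.tmul (f a) (g b) := by
  refine (MaxTensor.lift_tmul _ _ _ a b).trans ?_
  change MaxTensor.tmul (f a) 1 * MaxTensor.tmul 1 (g b) = _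
  rw [MaxTensor.tmul_mul_tmul, mul_one, one_mul]

theorem MaxTensor.inl_mul_inr (a : A) (b : B) :
    MaxTensor.inl A B a * MaxTensor.inr A B b = MaxTensor.tmul a b := by
  rw [MaxTensor.inl_apply, MaxTensor.inr_apply, MaxTensor.tmul_mul_tmul, mul_one, one_mul]

theorem MaxTensor.assoc_tmul {C : Type*} [CStarAlgebra C] (a : A) (b : B) (c : C) :
    MaxTensor.assoc A B C (MaxTensor.tmul (MaxTensor.tmul a b) c) =
      MaxTensor.tmul a (MaxTensor.tmul b c) := by
  refine (MaxTensor.lift_tmul _ _ _ _ c).trans ?_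
  rw [MaxTensor.assocLeft, MaxTensor.map_tmul]
  change MaxTensor.tmul a (MaxTensor.tmul b 1) *
    MaxTensor.tmul 1 (MaxTensor.tmul 1 c) = _
  simp only [MaxTensor.tmul_mul_tmul, mul_one, one_mul]

theorem MaxTensor.sum_tmul {ι : Type*} (s : Finset ι) (f : ι → A) (b : B) :
    MaxTensor.tmul (∑ i ∈ s, f i) b = ∑ i ∈ s, MaxTensor.tmul (f i) b := by
  simp only [MaxTensor.tmul, TensorProduct.sum_tmul, map_sum]

theorem MaxTensor.tmul_sum {ι : Type*} (s : Finset ι) (a : A) (f : ι → B) :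
    MaxTensor.tmul a (∑ i ∈ s, f i) = ∑ i ∈ s, MaxTensor.tmul a (f i) := by
  simp only [MaxTensor.tmul, TensorProduct.tmul_sum, map_sum]

namespace HopfCStarStructure

variable {I : Type*} [Fintype I] {z : Matrix I I A}

theorem IsFundamental.unique {H K : HopfCStarStructure A} (hz : z.Generates)
    (hH : H.IsFundamental z) (hK : K.IsFundamental z) : H = K := by
  have h1 : H.comul = K.comul :=
    hz.hom_ext fun i j => (hH.comul_apply i j).trans (hK.comul_apply i j).symm
  have h2 : H.counit = K.counit :=
    hz.hom_ext fun i j => (hH.counit_apply i j).trans (hK.counit_apply i j).symm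
  have h3 : H.antipode = K.antipode :=
    hz.hom_ext fun i j => (hH.antipode_apply i j).trans (hK.antipode_apply i j).symm
  cases H
  cases K
  cases h1
  cases h2
  cases h3
  rfl

/-- Both sides of each compatibility are continuous and determined by their values on the entries of
`z`, where both structures are given by the same formulas. -/
theorem IsFundamental.isHopfHom {H : HopfCStarStructure A} {K : HopfCStarStructure B}
    {y : Matrix I I B} (hz : z.Generates) (hH : H.IsFundamental z) (hK : K.IsFundamental y)
    (φ : A →⋆ₐ[ℂ] B) (hφ : ∀ i j, φ (z i j) = y i j) : H.IsHopfHom K φ where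
  map_comul a := by
    have h : K.comul.comp φ = (MaxTensor.map φ φ).comp H.comul := hz.hom_ext fun i j => by
      change K.comul (φ (z i j)) = MaxTensor.map φ φ (H.comul (z i j))
      rw [hφ, hK.comul_apply, hH.comul_apply, map_sum]
      simp only [MaxTensor.map_tmul, hφ]
    exact DFunLike.congr_fun h a
  map_counit a := by
    have h : K.counit.comp φ = H.counit := hz.hom_ext fun i j => by
      change K.counit (φ (z i j)) = _
      rw [hφ, hK.counit_apply, hH.counit_apply]
    exact DFunLike.congr_fun h a
  map_antipode a := by
    -- Both sides are anti-multiplicative maps from `A` to `B`, so the induction is run directly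
    -- instead of comparing ⋆-homomorphisms.
    refine hz.induction (P := fun a => (K.antipode (φ a)).unop = φ (H.antipode a).unop)
      (isClosed_eq (MulOpposite.continuous_unop.comp
        (K.antipode.continuous_cstar.comp φ.continuous_cstar))
        (φ.continuous_cstar.comp (MulOpposite.continuous_unop.comp H.antipode.continuous_cstar)))
      (fun i j => ?_) (fun c => ?_) (fun x y hx hy => ?_) (fun x y hx hy => ?_) a
    · rw [hφ, hK.antipode_apply, hH.antipode_apply, MulOpposite.unop_op, MulOpposite.unop_op, hφ]
    · simp only [AlgHomClass.commutes, MulOpposite.algebraMap_apply, MulOpposite.unop_op]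
    · simp only [map_add, MulOpposite.unop_add, hx, hy]
    · simp only [map_mul, MulOpposite.unop_mul, hx, hy]

end HopfCStarStructure

open Classical in
/-- A C⋆-algebra generated by a magic unitary `z` has a Hopf C⋆-algebra structure with
fundamental matrix `z` as soon as the comultiplication, the counit and the antipode exist as
⋆-homomorphisms. -/
theorem IsMagicUnitary.existsUnique_hopf {I : Type*} [Fintype I] {z : Matrix I I A}
    (hm : IsMagicUnitary z) (hz : z.Generates)
    (hΔ : ∃ Δ : A →⋆ₐ[ℂ] MaxTensor A A, ∀ i j, Δ (z i j) = ∑ k, MaxTensor.tmul (z i k) (z k j))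
    (hε : ∃ ε : A →⋆ₐ[ℂ] ℂ, ∀ i j, ε (z i j) = if i = j then 1 else 0)
    (hS : ∃ S : A →⋆ₐ[ℂ] Aᵐᵒᵖ, ∀ i j, S (z i j) = MulOpposite.op (z j i)) :
    ∃! H : HopfCStarStructure A, H.IsFundamental z := by
  obtain ⟨Δ, hΔ⟩ := hΔ
  obtain ⟨ε, hε⟩ := hε
  obtain ⟨S, hS⟩ := hS
  -- The entries are self-adjoint, so the subalgebra they generate is a ⋆-subalgebra; it serves as
  -- the dense Hopf ⋆-algebra.
  have hstar : star (Algebra.adjoin ℂ z.entries) = Algebra.adjoin ℂ z.entries := by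
    rw [Subalgebra.star_adjoin_comm]
    congr 1
    ext x
    constructor
    · rintro ⟨i, j, h⟩
      exact ⟨i, j, by
        rw [← star_star x, ← h]; exact (hm.isStarProjection i j).isSelfAdjoint.star_eq.symm⟩
    · rintro ⟨i, j, rfl⟩
      exact ⟨i, j, (hm.isStarProjection i j).isSelfAdjoint.star_eq.symm⟩
  let A₀ : StarSubalgebra ℂ A :=
    { Algebra.adjoin ℂ z.entries with
      star_mem' := fun {a} ha => by
        change a ∈ Algebra.adjoin ℂ z.entries at ha
        rw [← hstar] at ha
        exact ha }
  have hmem : ∀ i j, z i j ∈ A₀ := z.mem_adjoin_entries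
  have hSz : ∀ i j, (S (z i j)).unop = z j i := fun i j => by rw [hS, MulOpposite.unop_op]
  have hSA : ∀ a ∈ A₀, (S a).unop ∈ A₀ := by
    intro a ha
    refine Algebra.adjoin_induction (p := fun a _ => (S a).unop ∈ A₀) ?_ (fun c => ?_)
      (fun x y _ _ hx hy => ?_) (fun x y _ _ hx hy => ?_) ha
    · rintro _ ⟨i, j, rfl⟩
      rw [hSz]
      exact hmem j i
    · rw [AlgHomClass.commutes]
      exact A₀.algebraMap_mem c
    · rw [map_add]
      exact A₀.add_mem hx hy
    · rw [map_mul]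
      exact A₀.mul_mem hy hx
  let ι : A₀ ⊗[ℂ] A₀ →ₐ[ℂ] A ⊗[ℂ] A :=
    Algebra.TensorProduct.map (A₀.subtype : A₀ →ₐ[ℂ] A) (A₀.subtype : A₀ →ₐ[ℂ] A)
  have hA₀ : ∀ a ∈ A₀, ∃ t ∈ ι.range, MaxTensor.ofAlgebraic t = Δ a ∧
      antipodeMul S t = algebraMap ℂ A (ε a) ∧ mulAntipode S t = algebraMap ℂ A (ε a) := by
    -- The elements admitting a suitable `t` form a subalgebra, by `antipodeMul_mul` and
    -- `mulAntipode_mul` for products, so only entries and scalars need an explicit `t`.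
    intro a ha
    refine Algebra.adjoin_induction (p := fun a _ => ∃ t ∈ ι.range, MaxTensor.ofAlgebraic t = Δ a ∧
      antipodeMul S t = algebraMap ℂ A (ε a) ∧ mulAntipode S t = algebraMap ℂ A (ε a)) ?_
      (fun c => ?_) ?_ ?_ ha
    · rintro _ ⟨i, j, rfl⟩
      refine ⟨∑ k, z i k ⊗ₜ z k j, sum_mem fun k _ =>
        ⟨(⟨z i k, hmem i k⟩ : A₀) ⊗ₜ (⟨z k j, hmem k j⟩ : A₀), rfl⟩, ?_, ?_, ?_⟩
      · rw [map_sum, hΔ]; rfl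
      -- Each summand is S(z_ik) z_kj = z_ki z_kj. For i ≠ j it vanishes by orthogonality in row k;
      -- for i = j it is z_ki, and column i sums to 1.
      · simp only [map_sum, antipodeMul_tmul, hSz, hε]
        by_cases hij : i = j
        · subst hij
          simp only [(hm.isStarProjection _ _).isIdempotentElem.eq, hm.col_sum, if_true, map_one]
        · simp only [hm.row_orthogonal _ _ _ hij, hij, if_false, Finset.sum_const_zero, map_zero]
      · simp only [map_sum, mulAntipode_tmul, hSz, hε]
        by_cases hij : i = j
        · subst hij
          simp only [(hm.isStarProjection _ _).isIdempotentElem.eq, hm.row_sum, if_true, map_one]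
        · simp only [hm.col_orthogonal _ _ _ hij, hij, if_false, Finset.sum_const_zero, map_zero]
    · refine ⟨algebraMap ℂ _ c, ι.range.algebraMap_mem c, ?_, ?_, ?_⟩
      · rw [AlgHomClass.commutes, AlgHomClass.commutes]
      all_goals
        have h1 : (S (algebraMap ℂ A c)).unop = algebraMap ℂ A c := by
          rw [AlgHomClass.commutes]; rfl
        have h2 : ε (algebraMap ℂ A c) = c := AlgHomClass.commutes ε c
        simp [Algebra.TensorProduct.algebraMap_apply, antipodeMul_tmul, mulAntipode_tmul, h1, h2]
    · rintro x y - - ⟨s, hs, hs1, hs2, hs3⟩ ⟨t, ht, ht1, ht2, ht3⟩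
      exact ⟨s + t, add_mem hs ht, by rw [map_add, map_add, hs1, ht1],
        by rw [map_add, map_add, map_add, hs2, ht2], by rw [map_add, map_add, map_add, hs3, ht3]⟩
    · rintro x y - - ⟨s, hs, hs1, hs2, hs3⟩ ⟨t, ht, ht1, ht2, ht3⟩
      refine ⟨s * t, mul_mem hs ht, by rw [map_mul, map_mul, hs1, ht1], ?_, ?_⟩
      · rw [antipodeMul_mul S hs2, ht2, Algebra.smul_def, map_mul, map_mul]
      · rw [mulAntipode_mul S s ht3, hs3, Algebra.smul_def, map_mul, map_mul, Algebra.commutes]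
  let H : HopfCStarStructure A :=
    { comul := Δ
      counit := ε
      antipode := S
      coassoc := hz.hom_ext fun i j => by
        change MaxTensor.assoc A A A (MaxTensor.map Δ (StarAlgHom.id ℂ A) (Δ (z i j))) =
          MaxTensor.map (StarAlgHom.id ℂ A) Δ (Δ (z i j))
        simp only [hΔ, map_sum, MaxTensor.map_tmul, StarAlgHom.coe_id, id, MaxTensor.sum_tmul,
          MaxTensor.tmul_sum, MaxTensor.assoc_tmul]
        -- Both sides are ∑ z_ik ⊗ (z_kl ⊗ z_lj), with k and l summed in opposite orders.
        exact Finset.sum_comm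
      counit_comul := hz.hom_ext fun i j => by
        change MaxTensor.lift _ _ _ (Δ (z i j)) = z i j
        rw [hΔ, map_sum]
        refine (Finset.sum_congr rfl fun k _ => MaxTensor.lift_tmul _ _ _ _ _).trans ?_
        change ∑ k, algebraMap ℂ A (ε (z i k)) * z k j = _
        simp [hε]
      comul_counit := hz.hom_ext fun i j => by
        change MaxTensor.lift _ _ _ (Δ (z i j)) = z i j
        rw [hΔ, map_sum]
        refine (Finset.sum_congr rfl fun k _ => MaxTensor.lift_tmul _ _ _ _ _).trans ?_
        change ∑ k, z i k * algebraMap ℂ A (ε (z k j)) = _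
        simp [hε]
      antipode_antipode := fun a => by
        have hc : Continuous fun a => (S a).unop :=
          MulOpposite.continuous_unop.comp S.continuous_cstar
        refine hz.induction (P := fun a => (S (S a).unop).unop = a)
          (isClosed_eq (hc.comp hc) continuous_id) (fun i j => ?_) (fun c => ?_)
          (fun x y hx hy => ?_) (fun x y hx hy => ?_) a
        · rw [hSz, hSz]
        · simp only [AlgHomClass.commutes, MulOpposite.algebraMap_apply, MulOpposite.unop_op]
        · simp only [map_add, MulOpposite.unop_add, hx, hy]
        · simp only [map_mul, MulOpposite.unop_mul, hx, hy]
      exists_dense_hopf := ⟨A₀, hz, hSA, hA₀⟩ }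
  exact ⟨H, ⟨hm, hΔ, hε, hS⟩, fun K hK => hK.unique hz ⟨hm, hΔ, hε, hS⟩⟩

end Hopf

/-! ### Magic unitaries and adjacency matrices -/

section Adjacency

variable {R S I : Type*} [Ring R] [Ring S]

theorem adjacency_map (X : SimpleGraph I) {F : Type*} [FunLike F R S] [RingHomClass F R S] (f : F) :
    (adjacency X R).map f = adjacency X S := by
  ext i j
  simp only [adjacency, Matrix.map_apply, Matrix.of_apply, apply_ite f, map_one, map_zero]

theorem adjacency_comm (X : SimpleGraph I) (i j : I) : adjacency X R i j = adjacency X R j i := by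
  by_cases h : X.Adj i j
  · simp only [adjacency, Matrix.of_apply, h, h.symm, if_true]
  · simp only [adjacency, Matrix.of_apply, h, mt SimpleGraph.Adj.symm h, if_false]

theorem commute_adjacency (X : SimpleGraph I) (i j : I) (x : R) : Commute (adjacency X R i j) x := by
  simp only [adjacency, Matrix.of_apply]
  split_ifs
  · exact Commute.one_left x
  · exact Commute.zero_left x

end Adjacency

/-- Moving `e c` past `m c` brings it next to `e d`, which kills the cross terms. Nothing is asked
of `n`, so the right factor may be a row of a matrix that does not commute with `e`. -/
theorem sum_mul_sum_of_orthogonal {R J : Type*} [Ring R] [Fintype J] {e m n : J → R}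
    (he : ∀ c, IsIdempotentElem (e c))
    (he0 : ∀ c d, c ≠ d → e c * e d = 0) (hc : ∀ c, Commute (e c) (m c)) :
    (∑ c, e c * m c) * (∑ d, e d * n d) = ∑ c, e c * (m c * n c) := by
  rw [Finset.sum_mul]
  refine Finset.sum_congr rfl fun c _ => ?_
  rw [Finset.mul_sum, Finset.sum_eq_single c]
  · rw [(hc c).eq, mul_assoc, ← mul_assoc (e c), (he c).eq, ← mul_assoc, ← (hc c).eq, mul_assoc]
  · intro d _ hd
    rw [(hc c).eq, mul_assoc, ← mul_assoc (e c), he0 c d hd.symm, zero_mul, mul_zero]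
  · exact fun h => (h (Finset.mem_univ c)).elim

section MagicUnitary

variable {R S I J : Type*} [Ring R] [StarRing R] [Ring S] [StarRing S] [Fintype I] [Fintype J]

theorem IsMagicUnitary.map {u : Matrix I I R} (hu : IsMagicUnitary u) {F : Type*} [FunLike F R S]
    [RingHomClass F R S] [StarHomClass F R S] (f : F) : IsMagicUnitary (u.map f) where
  isStarProjection i j := (hu.isStarProjection i j).map f
  row_orthogonal i j k h := by
    rw [Matrix.map_apply, Matrix.map_apply, ← map_mul, hu.row_orthogonal i j k h, map_zero]
  col_orthogonal i j k h := by
    rw [Matrix.map_apply, Matrix.map_apply, ← map_mul, hu.col_orthogonal i j k h, map_zero]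
  row_sum i := by simp only [Matrix.map_apply, ← map_sum, hu.row_sum, map_one]
  col_sum i := by simp only [Matrix.map_apply, ← map_sum, hu.col_sum, map_one]

/-- The transpose of a magic unitary is a magic unitary over the opposite ring. -/
theorem IsMagicUnitary.op {u : Matrix I I R} (hu : IsMagicUnitary u) :
    IsMagicUnitary (u.transpose.map MulOpposite.op) where
  isStarProjection i j :=
    ⟨congrArg MulOpposite.op (hu.isStarProjection j i).isIdempotentElem,
      congrArg MulOpposite.op (hu.isStarProjection j i).isSelfAdjoint⟩
  row_orthogonal i j k h := congrArg MulOpposite.op (hu.col_orthogonal k j i h.symm)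
  col_orthogonal i j k h := congrArg MulOpposite.op (hu.row_orthogonal k j i h.symm)
  row_sum i := (Finset.op_sum _ _).symm.trans (congrArg MulOpposite.op (hu.col_sum i))
  col_sum i := (Finset.op_sum _ _).symm.trans (congrArg MulOpposite.op (hu.row_sum i))

/-- Gluing magic unitaries `u c` along a partition of unity `e` commuting with their entries. -/
theorem IsMagicUnitary.glue {e : J → R} (he : ∀ c, IsStarProjection (e c))
    (he0 : ∀ c d, c ≠ d → e c * e d = 0) (he1 : ∑ c, e c = 1) {u : J → Matrix I I R}
    (hu : ∀ c, IsMagicUnitary (u c)) (hc : ∀ c i j, Commute (e c) (u c i j)) :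
    IsMagicUnitary (Matrix.of fun i j => ∑ c, e c * u c i j) := by
  have hmul : ∀ i j k l, (∑ c, e c * u c i j) * (∑ d, e d * u d k l) =
      ∑ c, e c * (u c i j * u c k l) := by
    exact fun i j k l => sum_mul_sum_of_orthogonal (fun c => (he c).isIdempotentElem) he0
      fun c => hc c i j
  constructor
  · intro i j
    constructor
    · refine (hmul i j i j).trans ?_
      simp only [((hu _).isStarProjection i j).isIdempotentElem.eq, Matrix.of_apply]
    · rw [isSelfAdjoint_iff, Matrix.of_apply, star_sum]
      refine Finset.sum_congr rfl fun c _ => ?_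
      rw [star_mul, (he c).isSelfAdjoint.star_eq, ((hu c).isStarProjection i j).isSelfAdjoint.star_eq,
        (hc c i j).eq]
  · intro i j k h
    refine (hmul i j i k).trans ?_
    simp only [(hu _).row_orthogonal i j k h, mul_zero, Finset.sum_const_zero]
  · intro i j k h
    refine (hmul i k j k).trans ?_
    simp only [(hu _).col_orthogonal i j k h, mul_zero, Finset.sum_const_zero]
  · intro i
    simp only [Matrix.of_apply]
    rw [Finset.sum_comm]
    simp only [← Finset.mul_sum, (hu _).row_sum, mul_one, he1]
  · intro j
    simp only [Matrix.of_apply]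
    rw [Finset.sum_comm]
    simp only [← Finset.mul_sum, (hu _).col_sum, mul_one, he1]

/-- The product of two magic unitaries with commuting entries. -/
theorem IsMagicUnitary.mul {u v : Matrix I I R} (hu : IsMagicUnitary u) (hv : IsMagicUnitary v)
    (hc : ∀ i j k l, Commute (u i j) (v k l)) : IsMagicUnitary (u * v) := by
  have hmul : ∀ i j k l, (u * v) i j * (u * v) k l =
      ∑ c, ∑ d, u i c * u k d * (v c j * v d l) := by
    intro i j k l
    rw [Matrix.mul_apply, Matrix.mul_apply, Finset.sum_mul_sum]
    refine Finset.sum_congr rfl fun c _ => Finset.sum_congr rfl fun d _ => ?_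
    rw [mul_assoc, ← mul_assoc (v c j), ← (hc k d c j).eq]
    simp only [mul_assoc]
  -- Within one row of the product, the orthogonality of row i of `u` leaves only c = d. Across
  -- different rows this fails, and column orthogonality needs both factors.
  have hdiag : ∀ i j l, (u * v) i j * (u * v) i l = ∑ c, u i c * (v c j * v c l) := by
    intro i j l
    rw [hmul]
    refine Finset.sum_congr rfl fun c _ => ?_
    rw [Finset.sum_eq_single c]
    · rw [(hu.isStarProjection i c).isIdempotentElem.eq]
    · intro d _ hd
      rw [hu.row_orthogonal i c d hd.symm, zero_mul]
    · exact fun h => (h (Finset.mem_univ c)).elim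
  constructor
  · intro i j
    constructor
    · refine (hdiag i j j).trans ?_
      simp only [(hv.isStarProjection _ j).isIdempotentElem.eq, Matrix.mul_apply]
    · rw [isSelfAdjoint_iff, Matrix.mul_apply, star_sum]
      refine Finset.sum_congr rfl fun c _ => ?_
      rw [star_mul, (hu.isStarProjection i c).isSelfAdjoint.star_eq,
        (hv.isStarProjection c j).isSelfAdjoint.star_eq, (hc i c c j).eq]
  · intro i j k h
    rw [hdiag]
    simp only [hv.row_orthogonal _ j k h, mul_zero, Finset.sum_const_zero]
  · intro i j k h
    rw [hmul]
    refine Finset.sum_eq_zero fun c _ => Finset.sum_eq_zero fun d _ => ?_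
    by_cases hcd : c = d
    · rw [hcd, hu.col_orthogonal i j d h, zero_mul]
    · rw [hv.col_orthogonal c d k hcd, mul_zero]
  · intro i
    simp only [Matrix.mul_apply]
    rw [Finset.sum_comm]
    simp only [← Finset.mul_sum, hv.row_sum, mul_one, hu.row_sum]
  · intro j
    simp only [Matrix.mul_apply]
    rw [Finset.sum_comm]
    simp only [← Finset.sum_mul, hu.col_sum, one_mul, hv.col_sum]

/-- The free wreath product `w (i, a) (j, b) = u a i j * v a b` of magic unitaries. -/
theorem IsMagicUnitary.wreath {u : J → Matrix I I R} (hu : ∀ a, IsMagicUnitary (u a))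
    {v : Matrix J J R} (hv : IsMagicUnitary v) (hc : ∀ i j a b, Commute (u a i j) (v a b)) :
    IsMagicUnitary (Matrix.of fun x y : I × J => u x.2 x.1 y.1 * v x.2 y.2) := by
  have hrow : ∀ a b c i j k l, u a i j * v a b * (u a k l * v a c) =
      u a i j * u a k l * (v a b * v a c) := by
    intro a b c i j k l
    rw [mul_assoc, ← mul_assoc (v a b), ← (hc k l a b).eq]
    simp only [mul_assoc]
  constructor
  · rintro ⟨i, a⟩ ⟨j, b⟩
    constructor
    · refine (hrow a b b i j i j).trans ?_
      rw [((hu a).isStarProjection i j).isIdempotentElem.eq,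
        (hv.isStarProjection a b).isIdempotentElem.eq, Matrix.of_apply]
    · rw [isSelfAdjoint_iff, Matrix.of_apply, star_mul,
        ((hu a).isStarProjection i j).isSelfAdjoint.star_eq,
        (hv.isStarProjection a b).isSelfAdjoint.star_eq, (hc i j a b).eq]
  · rintro ⟨i, a⟩ ⟨j, b⟩ ⟨k, c⟩ h
    refine (hrow a b c i j i k).trans ?_
    by_cases hbc : b = c
    · rw [(hu a).row_orthogonal i j k fun hjk => h (by rw [hjk, hbc]), zero_mul]
    · rw [hv.row_orthogonal a b c hbc, mul_zero]
  · rintro ⟨i, a⟩ ⟨j, b⟩ ⟨k, c⟩ h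
    change u a i k * v a c * (u b j k * v b c) = 0
    by_cases hab : a = b
    · subst hab
      rw [hrow, (hu a).col_orthogonal i j k fun hij => h (by rw [hij]), zero_mul]
    -- Here `u b j k` is only known to commute with `v b c`, not with `v a c`. So it is moved to the
    -- right, making the two entries of column c of `v` adjacent.
    · rw [(hc j k b c).eq, mul_assoc, ← mul_assoc (v a c), hv.col_orthogonal a b c hab, zero_mul,
        mul_zero]
  · rintro ⟨i, a⟩
    simp only [Matrix.of_apply, Fintype.sum_prod_type]
    rw [Finset.sum_comm]
    simp only [← Finset.sum_mul, (hu a).row_sum, one_mul, hv.row_sum]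
  · rintro ⟨j, b⟩
    simp only [Matrix.of_apply, Fintype.sum_prod_type]
    rw [Finset.sum_comm]
    simp only [← Finset.sum_mul, (hu _).col_sum, one_mul, hv.col_sum]

theorem IsMagicUnitary.one [DecidableEq I] : IsMagicUnitary (1 : Matrix I I R) where
  isStarProjection i j := by
    rw [Matrix.one_apply]
    split_ifs
    · exact IsStarProjection.one R
    · exact IsStarProjection.zero R
  row_orthogonal i j k h := by
    rw [Matrix.one_apply, Matrix.one_apply]
    by_cases hij : i = j
    · rw [if_neg (hij ▸ h : i ≠ k), mul_zero]
    · rw [if_neg hij, zero_mul]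
  col_orthogonal i j k h := by
    rw [Matrix.one_apply, Matrix.one_apply]
    by_cases hij : i = k
    · rw [if_neg (hij ▸ h.symm : j ≠ k), mul_zero]
    · rw [if_neg hij, zero_mul]
  row_sum i := by simp [Matrix.one_apply]
  col_sum i := by simp [Matrix.one_apply]

/-- A magic unitary that commutes with the adjacency matrix of the graph `X`. -/
structure IsQAutMatrix (X : SimpleGraph I) (u : Matrix I I R) : Prop where
  magic : IsMagicUnitary u
  comm : adjacency X R * u = u * adjacency X R

variable {X : SimpleGraph I}

theorem IsQAutMatrix.map {u : Matrix I I R} (hu : IsQAutMatrix X u) {F : Type*} [FunLike F R S]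
    [RingHomClass F R S] [StarHomClass F R S] (f : F) : IsQAutMatrix X (u.map f) where
  magic := hu.magic.map f
  comm := by
    rw [← adjacency_map X f]
    have h := congrArg (fun m : Matrix I I R => m.map f) hu.comm
    simpa only [Matrix.map_mul] using h

/-- Transposition over the opposite ring reverses products of matrices, hence exchanges the two
sides of d u = u d; the adjacency matrix is symmetric and has central entries. -/
theorem IsQAutMatrix.op {u : Matrix I I R} (hu : IsQAutMatrix X u) :
    IsQAutMatrix X (u.transpose.map MulOpposite.op) where
  magic := hu.magic.op
  comm := by
    ext i j
    have h := congrFun (congrFun hu.comm j) i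
    have hop : ∀ k l, adjacency X Rᵐᵒᵖ k l = MulOpposite.op (adjacency X R l k) := by
      intro k l
      rw [adjacency_comm]
      simp only [adjacency, Matrix.of_apply]
      split_ifs <;> rfl
    simp only [Matrix.mul_apply, Matrix.map_apply, Matrix.transpose_apply, hop,
      ← MulOpposite.op_mul, ← Finset.op_sum] at h ⊢
    rw [h]

theorem IsQAutMatrix.mul {u v : Matrix I I R} (hu : IsQAutMatrix X u) (hv : IsQAutMatrix X v)
    (hc : ∀ i j k l, Commute (u i j) (v k l)) : IsQAutMatrix X (u * v) where
  magic := hu.magic.mul hv.magic hc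
  comm := by rw [← Matrix.mul_assoc, hu.comm, Matrix.mul_assoc, hv.comm, Matrix.mul_assoc]

theorem IsQAutMatrix.one [DecidableEq I] : IsQAutMatrix X (1 : Matrix I I R) where
  magic := .one
  comm := by rw [Matrix.mul_one, Matrix.one_mul]

/-- The entries of d are 0 or 1 and commute with each `e c`, so the relation holds separately on
each piece of the partition. -/
theorem IsQAutMatrix.glue {e : J → R} (he : ∀ c, IsStarProjection (e c))
    (he0 : ∀ c d, c ≠ d → e c * e d = 0) (he1 : ∑ c, e c = 1) {u : J → Matrix I I R}
    (hu : ∀ c, IsQAutMatrix X (u c)) (hc : ∀ c i j, Commute (e c) (u c i j)) :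
    IsQAutMatrix X (Matrix.of fun i j => ∑ c, e c * u c i j) where
  magic := .glue he he0 he1 (fun c => (hu c).magic) hc
  comm := by
    ext i j
    simp only [Matrix.mul_apply, Matrix.of_apply, Finset.mul_sum, Finset.sum_mul]
    rw [Finset.sum_comm, Finset.sum_comm (s := Finset.univ (α := I))]
    refine Finset.sum_congr rfl fun c _ => ?_
    simp only [← mul_assoc, (commute_adjacency X _ _ (e c)).eq]
    simp only [mul_assoc, ← Finset.mul_sum]
    rw [← Matrix.mul_apply, ← Matrix.mul_apply, (hu c).comm]

/-- With d_{X∘Y} = 𝟙⊗d_Y + d_X⊗1, the two summands are treated separately. In the first, summation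
over the X-index replaces u by 1 and leaves d_Y v = v d_Y; in the second, a is fixed and the
relation is d_X u⁽ᵃ⁾ = u⁽ᵃ⁾ d_X, multiplied by v_ab. -/
theorem IsQAutMatrix.wreath {Y : SimpleGraph J} {u : J → Matrix I I R}
    (hu : ∀ a, IsQAutMatrix X (u a)) {v : Matrix J J R} (hv : IsQAutMatrix Y v)
    (hc : ∀ i j a b, Commute (u a i j) (v a b)) :
    IsQAutMatrix (lexProduct X Y)
      (Matrix.of fun x y : I × J => u x.2 x.1 y.1 * v x.2 y.2) where
  magic := .wreath (fun a => (hu a).magic) hv.magic hc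
  comm := by
    classical
    -- The entries add up correctly because `Y` has no loops: the two kinds of edges exclude each
    -- other.
    have hadj : ∀ i j a b, adjacency (lexProduct X Y) R (i, a) (j, b) =
        adjacency Y R a b + if a = b then adjacency X R i j else 0 := by
      intro i j a b
      simp only [adjacency, lexProduct, Matrix.of_apply]
      by_cases hab : a = b
      · subst hab
        simp
      · simp [hab]
    ext ⟨i, a⟩ ⟨j, b⟩
    have hX := congrFun (congrFun (hu a).comm i) j
    have hY := congrFun (congrFun hv.comm a) b
    simp only [Matrix.mul_apply] at hX hY
    simp only [Matrix.mul_apply, Matrix.of_apply, Fintype.sum_prod_type, hadj, add_mul, mul_add,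
      Finset.sum_add_distrib]
    congr 1
    · rw [Finset.sum_comm, Finset.sum_comm (s := Finset.univ (α := I))]
      simp only [← Finset.mul_sum, ← Finset.sum_mul, (hu _).magic.col_sum, (hu _).magic.row_sum,
        one_mul, mul_assoc, hY]
    · simp only [ite_mul, mul_ite, zero_mul, mul_zero, Finset.sum_ite_eq, Finset.sum_ite_eq',
        Finset.mem_univ, if_true, mul_assoc, ← (commute_adjacency X _ _ (v a b)).eq]
      simp only [← mul_assoc, ← Finset.sum_mul, hX]

end MagicUnitary

/-! ### The universal properties -/

namespace FreeStarAlgebra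

variable {G C : Type*} [CStarAlgebra C]

/-- The ⋆-homomorphism with prescribed values on the generators. -/
def lift (f : G → C) : FreeStarAlgebra G →⋆ₐ[ℂ] C :=
  let g : FreeStarAlgebra G →ₐ[ℂ] C := FreeAlgebra.lift ℂ (Sum.elim f fun x => star (f x))
  have hg : ∀ x, g (letter x) = Sum.elim f (fun x => star (f x)) x :=
    FreeAlgebra.lift_ι_apply (R := ℂ) (Sum.elim f fun x => star (f x))
  { g with
    map_star' := fun x => by
      change g (star x) = star (g x)
      induction x using FreeStarAlgebra.induction with
      | h_const c =>
        rw [star_algebraMap, AlgHom.commutes, AlgHom.commutes, ← algebraMap_star_comm]; rfl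
      | h_gen x => cases x <;> simp [star_letter, hg]
      | h_mul x y hx hy => rw [star_mul, map_mul, hx, hy, map_mul, star_mul]
      | h_add x y hx hy => rw [star_add, map_add, hx, hy, map_add, star_add] }

theorem lift_gen (f : G → C) (x : G) : lift f (gen x) = f x :=
  FreeAlgebra.lift_ι_apply (R := ℂ) (Sum.elim f fun x => star (f x)) (Sum.inl x)

end FreeStarAlgebra

/-- A closed subalgebra that contains the generators of a universal C⋆-algebra and their adjoints
contains everything. -/
theorem UniversalCStarAlgebra.dense_of_letter_mem {G : Type*}
    {r : FreeStarAlgebra G → FreeStarAlgebra G → Prop} [BoundedRelations r]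
    (S : Subalgebra ℂ (UniversalCStarAlgebra r))
    (h : ∀ g, mk r (FreeStarAlgebra.gen g) ∈ closure (S : Set (UniversalCStarAlgebra r)))
    (h' : ∀ g, mk r (star (FreeStarAlgebra.gen g)) ∈
      closure (S : Set (UniversalCStarAlgebra r))) :
    Dense (S : Set (UniversalCStarAlgebra r)) := by
  have hm : ∀ x, mk r x ∈ S.topologicalClosure := by
    intro x
    induction x using FreeStarAlgebra.induction with
    | h_const c => rw [AlgHomClass.commutes]; exact Subalgebra.algebraMap_mem _ c
    | h_gen x =>
      rcases x with g | g
      · exact h g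
      · have := h' g
        rw [FreeStarAlgebra.gen, FreeStarAlgebra.star_letter] at this
        exact this
    | h_mul x y hx hy => rw [map_mul]; exact mul_mem hx hy
    | h_add x y hx hy => rw [map_add]; exact add_mem hx hy
  have hd : Dense (S.topologicalClosure : Set (UniversalCStarAlgebra r)) :=
    (denseRange_mk r).mono (by rintro _ ⟨x, rfl⟩; exact hm x)
  rw [Subalgebra.topologicalClosure_coe] at hd
  exact dense_closure.mp hd

/-! ### The algebra A(X): universal property and Hopf structure. -/

namespace QAut

variable {V : Type*} [Fintype V] (X : SimpleGraph V)

/-- Stated in the enveloping algebra itself, where the relations can be applied through `mk`;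
`isQAutMatrix_magic` is the same fact under the name A(X). -/
theorem isQAutMatrix_generators :
    IsQAutMatrix X ((generators V).map (UniversalCStarAlgebra.mk (QAutRel X))) where
  magic :=
    { isStarProjection := fun i j => by
        constructor
        · rw [IsIdempotentElem, Matrix.map_apply, ← map_mul]
          exact UniversalCStarAlgebra.mk_eq _ (.idem i j)
        · rw [isSelfAdjoint_iff, Matrix.map_apply, ← map_star]
          exact UniversalCStarAlgebra.mk_eq _ (.star i j)
      row_orthogonal := fun i j k h => by
        rw [Matrix.map_apply, Matrix.map_apply, ← map_mul]
        exact (UniversalCStarAlgebra.mk_eq _ (.row_orthogonal i j k h)).trans (map_zero _)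
      col_orthogonal := fun i j k h => by
        rw [Matrix.map_apply, Matrix.map_apply, ← map_mul]
        exact (UniversalCStarAlgebra.mk_eq _ (.col_orthogonal i j k h)).trans (map_zero _)
      row_sum := fun i => by
        simp only [Matrix.map_apply]
        rw [← map_sum]
        exact (UniversalCStarAlgebra.mk_eq _ (.row_sum i)).trans (map_one _)
      col_sum := fun i => by
        simp only [Matrix.map_apply]
        rw [← map_sum]
        exact (UniversalCStarAlgebra.mk_eq _ (.col_sum i)).trans (map_one _) }
  comm := by
    have h : (adjacency X _ * generators V).map (UniversalCStarAlgebra.mk (QAutRel X)) =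
        (generators V * adjacency X _).map (UniversalCStarAlgebra.mk (QAutRel X)) := by
      ext i j
      exact UniversalCStarAlgebra.mk_eq _ (.comm i j)
    rwa [Matrix.map_mul, Matrix.map_mul, adjacency_map] at h

theorem isQAutMatrix_magic : IsQAutMatrix X (magic X) := isQAutMatrix_generators X

theorem generates_magic : (magic X).Generates := by
  refine UniversalCStarAlgebra.dense_of_letter_mem (r := QAutRel X)
    (Algebra.adjoin ℂ (magic X).entries) (fun g => ?_) (fun g => ?_)
  · exact subset_closure ((magic X).mem_adjoin_entries g.1 g.2)
  · rw [UniversalCStarAlgebra.mk_eq _ (.star g.1 g.2)]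
    exact subset_closure ((magic X).mem_adjoin_entries g.1 g.2)

variable {X} {C : Type*} [CStarAlgebra C]

/-- The universal property of `A(X)`. -/
theorem exists_hom {m : Matrix V V C} (hm : IsQAutMatrix X m) :
    ∃ f : QAut X →⋆ₐ[ℂ] C, ∀ i j, f (magic X i j) = m i j := by
  let F := FreeStarAlgebra.lift fun p : V × V => m p.1 p.2
  have hF : ∀ i j, F (FreeStarAlgebra.gen (i, j)) = m i j := fun i j => FreeStarAlgebra.lift_gen _ _
  have hg : (generators V).map F = m := by
    ext i j
    exact hF i j
  refine ⟨UniversalCStarAlgebra.lift (r := QAutRel X) F ?_, fun i j =>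
    (UniversalCStarAlgebra.lift_mk F _ _).trans (hF i j)⟩
  intro x y h
  cases h with
  | star i j => rw [map_star, hF, (hm.magic.isStarProjection i j).isSelfAdjoint.star_eq]
  | idem i j => rw [map_mul, hF, (hm.magic.isStarProjection i j).isIdempotentElem.eq]
  | row_orthogonal i j k h => rw [map_mul, hF, hF, hm.magic.row_orthogonal i j k h, map_zero]
  | col_orthogonal i j k h => rw [map_mul, hF, hF, hm.magic.col_orthogonal i j k h, map_zero]
  | row_sum i => simp only [map_sum, hF, hm.magic.row_sum, map_one]
  | col_sum i => simp only [map_sum, hF, hm.magic.col_sum, map_one]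
  | comm i j =>
    rw [← Matrix.map_apply (f := F), ← Matrix.map_apply (f := F), Matrix.map_mul, Matrix.map_mul,
      adjacency_map, hg, hm.comm]

/-- Δ, ε and S come from three matrices satisfying the relations of A(X): the product of u⊗1 and
1⊗u, the identity matrix over ℂ, and the transpose of u over the opposite algebra. -/
theorem existsUnique_hopf (X : SimpleGraph V) :
    ∃! H : HopfCStarStructure (QAut X), H.IsFundamental (magic X) := by
  classical
  have hu := isQAutMatrix_magic X
  refine hu.magic.existsUnique_hopf (generates_magic X) ?_ ?_ ?_
  · obtain ⟨f, hf⟩ := exists_hom ((hu.map (MaxTensor.inl (QAut X) (QAut X))).mul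
      (hu.map (MaxTensor.inr (QAut X) (QAut X))) fun i j k l => MaxTensor.commute_inl_inr _ _)
    refine ⟨f, fun i j => (hf i j).trans (Finset.sum_congr rfl fun k _ => ?_)⟩
    exact MaxTensor.inl_mul_inr _ _
  · obtain ⟨f, hf⟩ := exists_hom (IsQAutMatrix.one (R := ℂ) (X := X))
    refine ⟨f, fun i j => (hf i j).trans ?_⟩
    rw [Matrix.one_apply]
  · obtain ⟨f, hf⟩ := exists_hom hu.op
    exact ⟨f, hf⟩

end QAut

/-! ### Free wreath products: universal property and generation by the entries of w. -/

namespace FreeWreath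

variable {A B C I J : Type*} [CStarAlgebra A] [CStarAlgebra B] [CStarAlgebra C]
  (u : Matrix I I A) (v : Matrix J J B)

theorem commute_left_right (i j : I) (a b : J) :
    Commute (left u v a (u i j)) (right u v (v a b)) := by
  have h := UniversalCStarAlgebra.mk_eq _ (FreeWreathRel.comm (u := u) (v := v) i j a b)
  rw [map_mul, map_mul] at h
  exact h

variable {u v} in
/-- The universal property of the free wreath product. -/
theorem exists_hom (f : J → A →⋆ₐ[ℂ] C) (g : B →⋆ₐ[ℂ] C)
    (h : ∀ i j a b, Commute (f a (u i j)) (g (v a b))) :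
    ∃ F : FreeWreath u v →⋆ₐ[ℂ] C,
      (∀ a x, F (left u v a x) = f a x) ∧ ∀ y, F (right u v y) = g y := by
  let F := FreeStarAlgebra.lift (Sum.elim (fun p : J × A => f p.1 p.2) g)
  have hl : ∀ a x, F (FreeStarAlgebra.gen (.inl (a, x))) = f a x :=
    fun a x => FreeStarAlgebra.lift_gen _ _
  have hr : ∀ x, F (FreeStarAlgebra.gen (.inr x)) = g x := fun x => FreeStarAlgebra.lift_gen _ _
  refine ⟨UniversalCStarAlgebra.lift (r := FreeWreathRel u v) F ?_,
    fun a x => (UniversalCStarAlgebra.lift_mk F _ _).trans (hl a x),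
    fun y => (UniversalCStarAlgebra.lift_mk F _ _).trans (hr y)⟩
  intro x y hxy
  cases hxy with
  | comm i j a b => rw [map_mul, map_mul, hl, hr, (h i j a b).eq]
  | _ => simp only [hl, hr, map_one, map_mul, map_add, map_smul, map_star]

variable {u v}

/-- This and the next identity recover the generators from w: v_ab from any fixed i, and u⁽ᵃ⁾ᵢⱼ by
summing over b. -/
theorem sum_magic_left [Fintype I] (hu : IsMagicUnitary u) (i : I) (a b : J) :
    ∑ j, magic u v (i, a) (j, b) = right u v (v a b) := by
  simp only [magic, Matrix.of_apply, ← Finset.sum_mul, ← map_sum, hu.row_sum, map_one, one_mul]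

theorem sum_magic_right [Fintype J] (hv : IsMagicUnitary v) (i j : I) (a : J) :
    ∑ b, magic u v (i, a) (j, b) = left u v a (u i j) := by
  simp only [magic, Matrix.of_apply, ← Finset.mul_sum, ← map_sum, hv.row_sum, map_one, mul_one]

theorem generates_magic [Fintype I] [Fintype J] [Nonempty I]
    (hu : IsMagicUnitary u) (hv : IsMagicUnitary v) (hu' : u.Generates) (hv' : v.Generates) : (magic u v).Generates := by
  let S := Algebra.adjoin ℂ (magic u v).entries
  have hl : ∀ a x, left u v a x ∈ S.topologicalClosure := fun a => by
    refine hu'.mem (S.topologicalClosure.comap (left u v a : A →ₐ[ℂ] FreeWreath u v))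
      (S.isClosed_topologicalClosure.preimage (left u v a).continuous_cstar) fun i j => ?_
    change left u v a (u i j) ∈ S.topologicalClosure
    rw [← sum_magic_right hv]
    exact sum_mem fun b _ => S.le_topologicalClosure ((magic u v).mem_adjoin_entries _ _)
  have hr : ∀ y, right u v y ∈ S.topologicalClosure := by
    refine hv'.mem (S.topologicalClosure.comap (right u v : B →ₐ[ℂ] FreeWreath u v))
      (S.isClosed_topologicalClosure.preimage (right u v).continuous_cstar) fun a b => ?_
    change right u v (v a b) ∈ S.topologicalClosure
    -- Nonemptiness enters here: with no index i, the matrix w would have no entries and v could not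
    -- be recovered.
    rw [← sum_magic_left hu (Classical.arbitrary I)]
    exact sum_mem fun b _ => S.le_topologicalClosure ((magic u v).mem_adjoin_entries _ _)
  refine UniversalCStarAlgebra.dense_of_letter_mem (r := FreeWreathRel u v) S ?_ ?_
  · rintro (⟨a, x⟩ | y)
    · exact hl a x
    · exact hr y
  · rintro (⟨a, x⟩ | y)
    · rw [← UniversalCStarAlgebra.mk_eq _ (.left_star a x)]
      exact hl a (star x)
    · rw [← UniversalCStarAlgebra.mk_eq _ (.right_star y)]
      exact hr (star y)

end FreeWreath

/-! ### The Hopf structure on the free wreath product A(X) *_w A(Y). -/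

section Wreath

variable {V W : Type*} [Fintype V] [Fintype W] (X : SimpleGraph V) (Y : SimpleGraph W)

theorem FreeWreath.isQAutMatrix_left (a : W) : IsQAutMatrix X
    ((QAut.magic X).map (left (QAut.magic X) (QAut.magic Y) a)) :=
  (QAut.isQAutMatrix_magic X).map _

theorem FreeWreath.isQAutMatrix_right : IsQAutMatrix Y
    ((QAut.magic Y).map (right (QAut.magic X) (QAut.magic Y))) :=
  (QAut.isQAutMatrix_magic Y).map _

theorem FreeWreath.isQAutMatrix_magic :
    IsQAutMatrix (lexProduct X Y) (magic (QAut.magic X) (QAut.magic Y)) := by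
  have h := IsQAutMatrix.wreath (isQAutMatrix_left X Y) (isQAutMatrix_right X Y)
    fun i j a b => by
      rw [Matrix.map_apply, Matrix.map_apply]
      exact commute_left_right (QAut.magic X) (QAut.magic Y) i j a b
  exact h

/-- Summing the desired Δ(w_{ia,jb}) over b, respectively over j, dictates Δ(u⁽ᵃ⁾ᵢⱼ) and Δ(v_ab) =
∑_c v_ac⊗v_cb. It remains to see that these values satisfy the relations of A(X), of A(Y) and of the
wreath product. -/
theorem FreeWreath.exists_comul :
    ∃ Δ : FreeWreath (QAut.magic X) (QAut.magic Y) →⋆ₐ[ℂ]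
      MaxTensor (FreeWreath (QAut.magic X) (QAut.magic Y))
        (FreeWreath (QAut.magic X) (QAut.magic Y)),
      ∀ p q, Δ (magic (QAut.magic X) (QAut.magic Y) p q) = ∑ r,
        MaxTensor.tmul (magic (QAut.magic X) (QAut.magic Y) p r)
          (magic (QAut.magic X) (QAut.magic Y) r q) := by
  let F := FreeWreath (QAut.magic X) (QAut.magic Y)
  let U : W → Matrix V V F := fun a => (QAut.magic X).map (left (QAut.magic X) (QAut.magic Y) a)
  let T : Matrix W W F := (QAut.magic Y).map (right (QAut.magic X) (QAut.magic Y))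
  have hU : ∀ a, IsQAutMatrix X (U a) := isQAutMatrix_left X Y
  have hT : IsQAutMatrix Y T := isQAutMatrix_right X Y
  have hUT : ∀ i j a b, Commute (U a i j) (T a b) := commute_left_right _ _
  have hlr : ∀ x y : F, Commute (MaxTensor.inl F F x) (MaxTensor.inr F F y) :=
    MaxTensor.commute_inl_inr
  have hT1 := (hT.map (MaxTensor.inl F F)).magic
  have hP : ∀ a c, IsQAutMatrix X
      ((U a).map (MaxTensor.inl F F) * (U c).map (MaxTensor.inr F F)) := fun a c =>
    ((hU a).map _).mul ((hU c).map _) fun i j k l => hlr _ _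
  -- v_ac⊗1 commutes with u⁽ᵃ⁾ᵢₖ⊗1 by the wreath relations, and with 1⊗u⁽ᶜ⁾ₖⱼ because the tensor
  -- legs commute.
  have hcomm : ∀ a c i j, Commute (MaxTensor.inl F F (T a c))
      (((U a).map (MaxTensor.inl F F) * (U c).map (MaxTensor.inr F F)) i j) := fun a c i j =>
    Commute.sum_right _ _ _ fun k _ => (((hUT i k a c).symm.map (MaxTensor.inl F F)).mul_right
      (hlr _ _))
  -- For fixed a, the partition of unity is row a of v⊗1, and the piece at c is (u⁽ᵃ⁾⊗1)(1⊗u⁽ᶜ⁾).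
  have hM := fun a => IsQAutMatrix.glue (hT1.isStarProjection a) (hT1.row_orthogonal a)
    (hT1.row_sum a) (hP a) (hcomm a)
  choose f hf using fun a => QAut.exists_hom (hM a)
  obtain ⟨g, hg⟩ := QAut.exists_hom ((hT.map (MaxTensor.inl F F)).mul (hT.map (MaxTensor.inr F F))
    fun i j k l => hlr _ _)
  have key : ∀ i j a b, f a (QAut.magic X i j) * g (QAut.magic Y a b) =
      ∑ c, ∑ k, MaxTensor.tmul (U a i k * T a c) (U c k j * T c b) := by
    intro i j a b
    rw [hf, hg]
    refine (sum_mul_sum_of_orthogonal (fun c => (hT1.isStarProjection a c).isIdempotentElem)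
      (hT1.row_orthogonal a) fun c => hcomm a c i j).trans (Finset.sum_congr rfl fun c _ => ?_)
    simp only [Matrix.mul_apply, Matrix.map_apply, Finset.sum_mul, Finset.mul_sum]
    refine Finset.sum_congr rfl fun k _ => ?_
    rw [← MaxTensor.inl_mul_inr, map_mul, map_mul, ← mul_assoc, ← mul_assoc, ← mul_assoc,
      ← map_mul, ← map_mul, (hUT i k a c).eq]
  -- The right side of `key` is a sum of tensors of projections w, hence self-adjoint. Taking
  -- adjoints in `key` reverses the product of the two projections, so they commute.
  have key' : ∀ i j a b, g (QAut.magic Y a b) * f a (QAut.magic X i j) =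
      ∑ c, ∑ k, MaxTensor.tmul (U a i k * T a c) (U c k j * T c b) := by
    intro i j a b
    have h := congrArg star (key i j a b)
    have hs1 := (((QAut.isQAutMatrix_magic X).magic.isStarProjection i j).map (f a)).isSelfAdjoint
    have hs2 := (((QAut.isQAutMatrix_magic Y).magic.isStarProjection a b).map g).isSelfAdjoint
    rw [star_mul, hs1.star_eq, hs2.star_eq, star_sum] at h
    rw [h]
    refine Finset.sum_congr rfl fun c _ => ?_
    rw [star_sum]
    refine Finset.sum_congr rfl fun k _ => ?_
    have hsa : ∀ i j a b, star (U a i j * T a b) = U a i j * T a b := fun i j a b =>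
      ((isQAutMatrix_magic X Y).magic.isStarProjection (i, a) (j, b)).isSelfAdjoint.star_eq
    rw [MaxTensor.tmul, ← map_star, TensorProduct.star_tmul, hsa, hsa]
  obtain ⟨Δ, hl, hr⟩ := exists_hom (u := QAut.magic X) (v := QAut.magic Y) f g
    fun i j a b => (key i j a b).trans (key' i j a b).symm
  refine ⟨Δ, ?_⟩
  rintro ⟨i, a⟩ ⟨j, b⟩
  rw [Fintype.sum_prod_type, Finset.sum_comm]
  refine Eq.trans ?_ (key i j a b)
  rw [magic, Matrix.of_apply, map_mul, hl, hr]

/-- Summing the desired S(w_{ia,jb}) = w_{jb,ia} over b gives S(u⁽ᵃ⁾ᵢⱼ) = ∑_c u⁽ᶜ⁾ⱼᵢ v_ca. Over the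
opposite algebra this is the gluing of the transposes of the u⁽ᶜ⁾ along row a of the transpose of v.
-/
theorem FreeWreath.exists_antipode :
    ∃ S : FreeWreath (QAut.magic X) (QAut.magic Y) →⋆ₐ[ℂ]
      (FreeWreath (QAut.magic X) (QAut.magic Y))ᵐᵒᵖ,
      ∀ p q, S (magic (QAut.magic X) (QAut.magic Y) p q) =
        MulOpposite.op (magic (QAut.magic X) (QAut.magic Y) q p) := by
  let F := FreeWreath (QAut.magic X) (QAut.magic Y)
  let U : W → Matrix V V F := fun a => (QAut.magic X).map (left (QAut.magic X) (QAut.magic Y) a)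
  let T : Matrix W W F := (QAut.magic Y).map (right (QAut.magic X) (QAut.magic Y))
  have hU : ∀ a, IsQAutMatrix X (U a) := isQAutMatrix_left X Y
  have hT : IsQAutMatrix Y T := isQAutMatrix_right X Y
  have hUT : ∀ i j a b, Commute (U a i j) (T a b) := commute_left_right _ _
  have hT1 := hT.op.magic
  have hcomm : ∀ a c i j, Commute (MulOpposite.op (T c a)) (MulOpposite.op (U c j i)) :=
    fun a c i j => (hUT j i c a).symm.op
  have hM := fun a => IsQAutMatrix.glue (hT1.isStarProjection a) (hT1.row_orthogonal a)
    (hT1.row_sum a) (fun c => (hU c).op) (hcomm a)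
  choose f hf using fun a => QAut.exists_hom (hM a)
  obtain ⟨g, hg⟩ := QAut.exists_hom hT.op
  have key : ∀ i j a b, f a (QAut.magic X i j) * g (QAut.magic Y a b) =
      MulOpposite.op (U b j i * T b a) := by
    intro i j a b
    have h := hT1.row_orthogonal a
    have h2 : MulOpposite.op (T b a) * MulOpposite.op (T b a) = MulOpposite.op (T b a) :=
      (hT1.isStarProjection a b).isIdempotentElem
    rw [hf, hg]
    change (∑ c, MulOpposite.op (T c a) * MulOpposite.op (U c j i)) * MulOpposite.op (T b a) = _
    -- Multiplication by v_ba selects the piece c = b of the gluing, since v_ca and v_ba are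
    -- orthogonal for c ≠ b.
    rw [Finset.sum_mul, Finset.sum_eq_single b]
    · rw [(hcomm a b i j).eq, mul_assoc, h2, ← (hcomm a b i j).eq, MulOpposite.op_mul]
    · intro c _ hc
      have h3 : MulOpposite.op (T c a) * MulOpposite.op (T b a) = 0 := h c b hc
      rw [(hcomm a c i j).eq, mul_assoc, h3, mul_zero]
    · exact fun h => (h (Finset.mem_univ b)).elim
  -- The wreath relations follow as for Δ: the product in `key` is the self-adjoint w_{jb,ia}, so
  -- its two projection factors commute.
  obtain ⟨S, hl, hr⟩ := exists_hom (u := QAut.magic X) (v := QAut.magic Y) f g fun i j a b => by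
    have h := congrArg star (key i j a b)
    have hs1 := (((QAut.isQAutMatrix_magic X).magic.isStarProjection i j).map (f a)).isSelfAdjoint
    have hs2 := (((QAut.isQAutMatrix_magic Y).magic.isStarProjection a b).map g).isSelfAdjoint
    have hsa : star (U b j i * T b a) = U b j i * T b a :=
      ((isQAutMatrix_magic X Y).magic.isStarProjection (j, b) (i, a)).isSelfAdjoint.star_eq
    rw [star_mul, hs1.star_eq, hs2.star_eq, ← MulOpposite.op_star, hsa] at h
    exact (key i j a b).trans h.symm
  refine ⟨S, ?_⟩
  rintro ⟨i, a⟩ ⟨j, b⟩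
  refine Eq.trans ?_ (key i j a b)
  rw [magic, Matrix.of_apply, map_mul, hl, hr]

/-- Only the counit remains. It restricts to the counit of A(X) on every copy and to that of A(Y),
and the wreath relations are automatic in the commutative algebra ℂ. -/
theorem FreeWreath.existsUnique_hopf [Nonempty V] :
    ∃! H : HopfCStarStructure (FreeWreath (QAut.magic X) (QAut.magic Y)),
      H.IsFundamental (magic (QAut.magic X) (QAut.magic Y)) := by
  classical
  have hX := (QAut.isQAutMatrix_magic X).magic
  have hY := (QAut.isQAutMatrix_magic Y).magic
  refine (isQAutMatrix_magic X Y).magic.existsUnique_hopf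
    (generates_magic hX hY (QAut.generates_magic X) (QAut.generates_magic Y))
    (exists_comul X Y) ?_ (exists_antipode X Y)
  obtain ⟨f, hf⟩ := QAut.exists_hom (IsQAutMatrix.one (R := ℂ) (X := X))
  obtain ⟨g, hg⟩ := QAut.exists_hom (IsQAutMatrix.one (R := ℂ) (X := Y))
  obtain ⟨ε, hl, hr⟩ := exists_hom (u := QAut.magic X) (v := QAut.magic Y) (fun _ => f) g
    fun _ _ _ _ => Commute.all _ _
  refine ⟨ε, ?_⟩
  rintro ⟨i, a⟩ ⟨j, b⟩
  rw [magic, Matrix.of_apply, map_mul, hl, hr, hf, hg, Matrix.one_apply, Matrix.one_apply]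
  by_cases hij : i = j <;> by_cases hab : a = b <;> simp [hij, hab]

end Wreath

end

/-- The morphism property is stated for all `H` and `K` with the given fundamental matrices; by the
existence and uniqueness clauses there is exactly one such pair. -/
theorem proposition6p1 {V W : Type*} [Fintype V] [Nonempty V] [Fintype W]
    (X : SimpleGraph V) (Y : SimpleGraph W) :
    (∃! H : HopfCStarStructure (QAut X), H.IsFundamental (QAut.magic X)) ∧
    (∃! H : HopfCStarStructure (QAut Y), H.IsFundamental (QAut.magic Y)) ∧
    (∃! H : HopfCStarStructure (QAut (lexProduct X Y)),
      H.IsFundamental (QAut.magic (lexProduct X Y))) ∧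
    (∃! H : HopfCStarStructure (FreeWreath (QAut.magic X) (QAut.magic Y)),
      H.IsFundamental (FreeWreath.magic (QAut.magic X) (QAut.magic Y))) ∧
    ∃ φ : QAut (lexProduct X Y) →⋆ₐ[ℂ] FreeWreath (QAut.magic X) (QAut.magic Y),
      (∀ (H : HopfCStarStructure (QAut (lexProduct X Y)))
        (K : HopfCStarStructure (FreeWreath (QAut.magic X) (QAut.magic Y))),
        H.IsFundamental (QAut.magic (lexProduct X Y)) →
        K.IsFundamental (FreeWreath.magic (QAut.magic X) (QAut.magic Y)) →
        H.IsHopfHom K φ) ∧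
      Function.Surjective φ ∧
      ∀ (i j : V) (a b : W), φ (QAut.magic (lexProduct X Y) (i, a) (j, b)) =
        FreeWreath.left (QAut.magic X) (QAut.magic Y) a (QAut.magic X i j) *
          FreeWreath.right (QAut.magic X) (QAut.magic Y) (QAut.magic Y a b) := by
  refine ⟨QAut.existsUnique_hopf X, QAut.existsUnique_hopf Y, QAut.existsUnique_hopf _,
    FreeWreath.existsUnique_hopf X Y, ?_⟩
  obtain ⟨φ, hφ⟩ := QAut.exists_hom (FreeWreath.isQAutMatrix_magic X Y)
  have hg := FreeWreath.generates_magic (QAut.isQAutMatrix_magic X).magic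
    (QAut.isQAutMatrix_magic Y).magic (QAut.generates_magic X) (QAut.generates_magic Y)
  exact ⟨φ, fun H K hH hK => hH.isHopfHom (QAut.generates_magic _) hK φ hφ,
    hg.surjective φ fun p q => ⟨_, hφ p q⟩, fun i j a b => hφ (i, a) (j, b)⟩
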